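/- Let $L$ be a finite set and let $\mathcal M$ be a collection of subsets of $L$, called contexts. Fix an ordering $C=(a_1,\dots,a_k)$ of the elements of each context $C\in\mathcal M$ and signs $\epsilon_C(a)\in\{\pm1\}$ for $C\in\mathcal M$, $a\in C$ (for example $\epsilon_C(a)=\epsilon(a)$ for a function $\epsilon:L\to\{\pm1\}$). Call this data a signed arrangement. Let $d\ge 2$, $\omega=e^{2\pi i/d}$ and $\tau:\mathcal M\to\mathbb Z_d$. An *operator realization* of $(L,\mathcal M,\epsilon,\tau)$ is a function $T:L\to U(n)$, for some $n\ge1$, such that $T_a^d=I$ for all $a\in L$ and $T_{a_1}^{\epsilon_C(a_1)}\cdots T_{a_k}^{\epsilon_C(a_k)}=\omega^{\tau(C)}I$ for each context $C=(a_1,\dots,a_k)$. It is a *quantum realization* if moreover the operators $T_a$, $a\in C$, commute pairwise for each context $C$. A *classical realization* is a function $c:L\to\mathbb Z_d$ with $\prod_{a\in C}\omega^{\epsilon_C(a)c(a)}=\omega^{\tau(C)}$ for each context $C$. The signed arrangement is *magic* (for $d$) if there is a $\tau$ for which it has a quantum realization but no classical realization. Let $X_{\mathrm{sing}}$ be the cell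 complex with one vertex, one $1$-cell (loop) for each $a\in L$, and one $2$-cell for each context $C=(a_1,\dots,a_k)$, glued along the closed path that traverses the loops of $a_1,\dots,a_k$ in this order, each in the direction given by $\epsilon_C(a_i)$ (along the constant path if $C=\emptyset$). A *topological realization* of the signed arrangement is a connected CW complex $X$ of dimension at most $2$ together with a map $X\to X_{\mathrm{sing}}$ of cell complexes (a continuous map that takes vertices to the vertex and is compatible with the characteristic maps of the cells) that induces bijections on the sets of $1$-cells and of $2$-cells. Through the bijection on $2$-cells, $\tau$ is a cellular $2$-cocycle on $X$ and has a class $[\tau]\in H^2(X,\mathbb Z_d)$. **Theorem.** Suppose that a signed arrangement has a topological realization by a simply connected complex $X$, and let $d\ge2$. Then the arrangement is not magic. More generally, for every $\tau:\mathcal M\to\mathbb Z_d$ such that $(L,\mathcal M,\epsilon,\tau)$ has an operator realization, $[\tau]=0$ in $H^2(X,\mathbb Z_d)$, and $(L,\mathcal M,\epsilon,\tau)$ has a classical realization. -/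

import Mathlib

open Topology

universe u v

noncomputable section

/-- A signed arrangement on a label set `L`: a collection of subsets of `L` (the contexts), an
ordering of the elements of every context, and signs `±1`. The signs may depend on the context in
which a label occurs; a sign function on `L` alone is the case `sign C a = ε a`. -/
structure SignedArrangement (L : Type u) where
  contexts : Finset (Finset L)
  order : {C : Finset L // C ∈ contexts} → List L
  order_spec : ∀ C, (order C : Multiset L) = C.1.val
  sign : {C : Finset L // C ∈ contexts} → L → ℤˣ

namespace SignedArrangement

variable {L : Type u} (A : SignedArrangement L)

/-- The type of contexts. -/
abbrev Context : Type u := {C : Finset L // C ∈ A.contexts}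

section Realizations

variable {d : ℕ} [NeZero d]

/-- `T : L → U(n)` with `T_a ^ d = 1` for every label, and with
`T_{a_1}^{ε(a_1)} ⋯ T_{a_k}^{ε(a_k)} = ω^{τ(C)}` for every context `C = (a_1, …, a_k)`, where
`ω = exp (2πi/d)`. (`ZMod.stdAddChar j` is `ω ^ j`.) -/
structure IsOperatorRealization (τ : A.Context → ZMod d) {n : ℕ}
    (T : L → Matrix.unitaryGroup (Fin n) ℂ) : Prop where
  pow_eq_one : ∀ a, T a ^ d = 1
  constraint : ∀ C : A.Context,
    (((A.order C).map fun a => T a ^ (A.sign C a : ℤ)).prod : Matrix (Fin n) (Fin n) ℂ) =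
      (ZMod.stdAddChar (τ C) : ℂ) • (1 : Matrix (Fin n) (Fin n) ℂ)

/-- An operator realization in which the operators of every context commute pairwise. -/
structure IsQuantumRealization (τ : A.Context → ZMod d) {n : ℕ}
    (T : L → Matrix.unitaryGroup (Fin n) ℂ) : Prop extends A.IsOperatorRealization τ T where
  commute : ∀ C : A.Context, ∀ a ∈ C.1, ∀ b ∈ C.1, Commute (T a) (T b)

/-- `c : L → ℤ_d` with `∏_{a ∈ C} ω^{ε(a) c(a)} = ω^{τ(C)}` for every context `C`. -/
def IsClassicalRealization (τ : A.Context → ZMod d) (c : L → ZMod d) : Prop :=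
  ∀ C : A.Context,
    ∏ a ∈ C.1, (ZMod.stdAddChar (((A.sign C a : ℤ) : ZMod d) * c a) : ℂ) =
      (ZMod.stdAddChar (τ C) : ℂ)

/-- Existence of an operator realization in some positive dimension. -/
def OperatorRealizable (τ : A.Context → ZMod d) : Prop :=
  ∃ n : ℕ, 0 < n ∧ ∃ T : L → Matrix.unitaryGroup (Fin n) ℂ, A.IsOperatorRealization τ T

/-- Existence of a quantum realization in some positive dimension. -/
def QuantumRealizable (τ : A.Context → ZMod d) : Prop :=
  ∃ n : ℕ, 0 < n ∧ ∃ T : L → Matrix.unitaryGroup (Fin n) ℂ, A.IsQuantumRealization τ T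

/-- Existence of a classical realization. -/
def ClassicallyRealizable (τ : A.Context → ZMod d) : Prop :=
  ∃ c : L → ZMod d, A.IsClassicalRealization τ c

variable (d) in
/-- The arrangement is magic (for `ℤ_d`) if some choice of constraints has a quantum realization
but no classical realization. -/
def IsMagic : Prop :=
  ∃ τ : A.Context → ZMod d, A.QuantumRealizable τ ∧ ¬ A.ClassicallyRealizable τ

end Realizations

end SignedArrangement

/-! ### Cells

Mathlib's characteristic maps of `n`-cells live on the closed unit ball of `Fin n → ℝ` for the
maximum norm, i.e. on the cube `[-1, 1] ^ n`. -/

/-- The closed `n`-cell `[-1, 1] ^ n`. -/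
abbrev ClosedCube (n : ℕ) : Type := Metric.closedBall (0 : Fin n → ℝ) 1

/-- The point of the unit circle with angle `2πs`. -/
def circlePoint (s : ℝ) : Fin 2 → ℝ :=
  ![Real.cos (2 * Real.pi * s), Real.sin (2 * Real.pi * s)]

theorem circlePoint_ne_zero (s : ℝ) : circlePoint s ≠ 0 := by
  intro h
  have h0 : Real.cos (2 * Real.pi * s) = 0 := by simpa [circlePoint] using congrFun h 0
  have h1 : Real.sin (2 * Real.pi * s) = 0 := by simpa [circlePoint] using congrFun h 1
  have := Real.sin_sq_add_cos_sq (2 * Real.pi * s)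
  simp [h0, h1] at this

/-- The loop `[0, 1] → ∂[-1, 1]²` that traverses the boundary of the closed `2`-cell once: the
radial projection of the unit circle. -/
def boundaryLoop (s : ℝ) : ClosedCube 2 :=
  ⟨‖circlePoint s‖⁻¹ • circlePoint s, by
    have := norm_ne_zero_iff.2 (circlePoint_ne_zero s)
    simp [norm_smul, this]⟩

/-- The path `[0, 1] → [-1, 1]` that traverses the closed `1`-cell from `-1` to `1` if the sign is
`1`, and backwards if the sign is `-1`. -/
def edgePath (ε : ℤˣ) (t : unitInterval) : ClosedCube 1 :=
  ⟨fun _ => ((ε : ℤ) : ℝ) * (2 * (t : ℝ) - 1), by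
    have h0 := t.2.1
    have h1 := t.2.2
    have h : |2 * (t : ℝ) - 1| ≤ 1 := abs_le.2 ⟨by linarith, by linarith⟩
    rw [mem_closedBall_zero_iff, pi_norm_le_iff_of_nonneg zero_le_one]
    intro _
    rcases Int.units_eq_one_or ε with rfl | rfl <;> simpa [abs_sub_comm] using h⟩

namespace SignedArrangement

variable {L : Type u} (A : SignedArrangement L)

/-! ### The one-vertex complex of an arrangement -/

/-- The disjoint union of a point, a closed `1`-cell for every label and a closed `2`-cell for
every context. -/
abbrev PreSing : Type u :=
  PUnit.{u + 1} ⊕ (Σ _ : L, ClosedCube 1) ⊕ (Σ _ : A.Context, ClosedCube 2)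

/-- The gluing: both end points of every `1`-cell go to the vertex, and the boundary of the
`2`-cell of `C = (a_1, …, a_k)`, divided into `k` segments, runs through the `1`-cells of
`a_1, …, a_k` in this order, each in the direction given by its sign. -/
inductive Glue : A.PreSing → A.PreSing → Prop
  | edge (a : L) (x : ClosedCube 1) (hx : ‖(x : Fin 1 → ℝ)‖ = 1) :
      Glue (.inr (.inl ⟨a, x⟩)) (.inl PUnit.unit)
  | face (C : A.Context) (i : Fin (A.order C).length) (t : unitInterval) :
      Glue (.inr (.inr ⟨C, boundaryLoop (((i : ℕ) + (t : ℝ)) / (A.order C).length)⟩))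
        (.inr (.inl ⟨(A.order C).get i, edgePath (A.sign C ((A.order C).get i)) t⟩))
  | face_nil (C : A.Context) (hC : A.order C = []) (x : ClosedCube 2)
      (hx : ‖(x : Fin 2 → ℝ)‖ = 1) :
      Glue (.inr (.inr ⟨C, x⟩)) (.inl PUnit.unit)

/-- The cell complex of an arrangement with a single vertex. -/
def Sing : Type u := Quot A.Glue

instance : TopologicalSpace A.Sing := inferInstanceAs (TopologicalSpace (Quot A.Glue))

/-- The vertex. -/
def singVertex : A.Sing := Quot.mk A.Glue (.inl PUnit.unit)

/-- The characteristic map of the `1`-cell of a label. -/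
def singEdge (a : L) (x : ClosedCube 1) : A.Sing := Quot.mk A.Glue (.inr (.inl ⟨a, x⟩))

/-- The characteristic map of the `2`-cell of a context. -/
def singFace (C : A.Context) (x : ClosedCube 2) : A.Sing := Quot.mk A.Glue (.inr (.inr ⟨C, x⟩))

/-! ### Topological realizations -/

/-- A topological realization of an arrangement: a connected CW complex `X` of dimension at most
two, together with a map to the one-vertex complex that is a map of cell complexes (it takes
vertices to the vertex and is compatible with the characteristic maps) and induces bijections on
the `1`-cells and on the `2`-cells. -/
structure TopologicalRealization (X : Type v) [TopologicalSpace X] [T2Space X]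
    [CWComplex (Set.univ : Set X)] where
  connected : ConnectedSpace X
  dim_le_two : ∀ n, 2 < n → IsEmpty (RelCWComplex.cell (Set.univ : Set X) n)
  toSing : C(X, A.Sing)
  edgeLabel : RelCWComplex.cell (Set.univ : Set X) 1 ≃ L
  faceLabel : RelCWComplex.cell (Set.univ : Set X) 2 ≃ A.Context
  toSing_vertex : ∀ (p : RelCWComplex.cell (Set.univ : Set X) 0) (x : ClosedCube 0),
    toSing (RelCWComplex.map 0 p x) = A.singVertex
  toSing_edge : ∀ (e : RelCWComplex.cell (Set.univ : Set X) 1) (x : ClosedCube 1),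
    toSing (RelCWComplex.map 1 e x) = A.singEdge (edgeLabel e) x
  toSing_face : ∀ (e : RelCWComplex.cell (Set.univ : Set X) 2) (x : ClosedCube 2),
    toSing (RelCWComplex.map 2 e x) = A.singFace (faceLabel e) x

end SignedArrangement

/-! ### Cellular cohomology in degree two -/

section Cohomology

variable (X : Type v) [TopologicalSpace X] [CWComplex (Set.univ : Set X)]

variable {X} in
/-- `m` is the degree of the loop obtained from the attaching map of the `2`-cell `e` by collapsing
the complement of the open `1`-cell `a` in the `1`-skeleton to a point. The quotient is identified
with the circle `ℝ / ℤ` (the open cell `(-1, 1)` with `(0, 1)`, and the collapsed part with `0`),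
`g` is a lift of the resulting loop to `ℝ`, and the degree is `g 1 - g 0`. -/
def IsIncidence (e : RelCWComplex.cell (Set.univ : Set X) 2)
    (a : RelCWComplex.cell (Set.univ : Set X) 1) (m : ℤ) : Prop :=
  ∃ g : C(unitInterval, ℝ),
    (∀ (t : unitInterval) (x : Fin 1 → ℝ), x ∈ Metric.ball (0 : Fin 1 → ℝ) 1 →
      RelCWComplex.map 2 e (boundaryLoop (t : ℝ)) = RelCWComplex.map 1 a x →
        ∃ k : ℤ, g t = (x 0 + 1) / 2 + k) ∧
    (∀ t : unitInterval,
      (RelCWComplex.map 2 e (boundaryLoop (t : ℝ)) : X) ∉ RelCWComplex.openCell 1 a →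
        ∃ k : ℤ, g t = k) ∧
    g 1 - g 0 = m

variable {X} in
open Classical in
/-- The incidence number `[e : a]` of a `2`-cell and a `1`-cell. -/
def incidence (e : RelCWComplex.cell (Set.univ : Set X) 2)
    (a : RelCWComplex.cell (Set.univ : Set X) 1) : ℤ :=
  if h : ∃ m, IsIncidence e a m then h.choose else 0

/-- The cellular coboundary `C¹(X, ℤ_d) → C²(X, ℤ_d)`, `(δf)(e) = ∑_a [e : a] f(a)`, of a CW
complex with finitely many `1`-cells. -/
def cellularCoboundary [Finite (RelCWComplex.cell (Set.univ : Set X) 1)] (d : ℕ) :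
    (RelCWComplex.cell (Set.univ : Set X) 1 → ZMod d) →+
      (RelCWComplex.cell (Set.univ : Set X) 2 → ZMod d) where
  toFun f e := ∑ᶠ a, (incidence e a : ZMod d) * f a
  map_zero' := by ext e; simp
  map_add' f g := by
    ext e
    simp only [Pi.add_apply, mul_add]
    exact finsum_add_distrib (Set.toFinite _) (Set.toFinite _)

/-- The cellular cohomology group `H²(X, ℤ_d)` of a CW complex of dimension at most two with
finitely many `1`-cells: all `2`-cochains are cocycles, so it is the cokernel of the coboundary. -/
abbrev CellularH2 [Finite (RelCWComplex.cell (Set.univ : Set X) 1)] (d : ℕ) : Type v :=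
  (RelCWComplex.cell (Set.univ : Set X) 2 → ZMod d) ⧸ (cellularCoboundary X d).range

end Cohomology

namespace SignedArrangement.TopologicalRealization

variable {L : Type u} {A : SignedArrangement L} {X : Type v} [TopologicalSpace X] [T2Space X]
  [CWComplex (Set.univ : Set X)]

theorem finite_edges [Finite L] (R : A.TopologicalRealization X) :
    Finite (RelCWComplex.cell (Set.univ : Set X) 1) :=
  Finite.of_equiv L R.edgeLabel.symm

/-- The class `[τ]` in `H²(X, ℤ_d)` of the `2`-cochain that takes the value `τ(C)` on the `2`-cell
labelled by `C`. -/
def cohomologyClass [Finite L] (R : A.TopologicalRealization X) {d : ℕ}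
    (τ : A.Context → ZMod d) :
    haveI := R.finite_edges
    CellularH2 X d :=
  haveI := R.finite_edges
  QuotientAddGroup.mk fun e => τ (R.faceLabel e)

end SignedArrangement.TopologicalRealization

end

-- Modulo scalars, an operator realization labels the loops of the one-vertex complex by elements `h
-- a` of a group `G` for which every context word is trivial. Such a labelling is a flat `G`-bundle,
-- that is, a covering with discrete fibre `G` whose monodromy along the loop of `a` is right
-- multiplication by `h a`. Pulled back to a simply connected `X` it has no monodromy, so lifting
-- paths from a base point gives a potential `V : X → G` with `V(target) = V(source) * h a` on every
-- edge (`exists_potential`).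
--
-- This is used twice. First, `G` is `GL_n(ℂ)` modulo scalars. Lifting the potential to matrices `W`
-- gives `T_a = z_a W(source)⁻¹ W(target)` with scalar `z_a`. The boundary of a 2-cell of `X` is a
-- closed edge path, so the `W`-factors telescope and `z` satisfies the constraints of `T`
-- (`prod_word_of_eq_mul`, `exists_central_labelling`). Second, `G = ℂˣ` and the labelling is `z ^
-- d`, whose words are trivial because the right-hand sides are `d`-th roots of unity. Dividing `z`
-- by the coboundary of pointwise `d`-th roots of the potential makes its values `d`-th roots of
-- unity (`exists_labelling_pow_eq_one`). This is a classical realization `c`.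
--
-- Finally, the incidence number of a 2-cell and an edge is the sign of the label in the context, or
-- `0` if it does not occur (`incidence_eq`). The equations for `c` therefore say that its
-- coboundary is `τ`, so `[τ] = 0`.
--
-- The bundle is built by hand. Three open sets, the unions of the open stars of vertices, edges and
-- faces in the barycentric subdivision, cover the complex, and the transition functions are locally
-- constant on their overlaps.

universe w

/-! ### Polar coordinates on the closed 2-cell -/

/-- The angle of a point of the plane, as a fraction of a full turn. -/
noncomputable def turnAngle (y : Fin 2 → ℝ) : ℝ :=
  Int.fract (Complex.arg ⟨y 0, y 1⟩ / (2 * Real.pi))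

theorem circlePoint_add_int (s : ℝ) (n : ℤ) : circlePoint (s + n) = circlePoint s := by
  have h : 2 * Real.pi * (s + n) = 2 * Real.pi * s + n * (2 * Real.pi) := by ring
  simp [circlePoint, h, Real.cos_add_int_mul_two_pi, Real.sin_add_int_mul_two_pi]

theorem circlePoint_fract (s : ℝ) : circlePoint (Int.fract s) = circlePoint s := by
  conv_rhs => rw [← Int.fract_add_floor s]
  rw [circlePoint_add_int]

theorem coe_boundaryLoop (s : ℝ) :
    (boundaryLoop s : Fin 2 → ℝ) = ‖circlePoint s‖⁻¹ • circlePoint s := rfl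

theorem boundaryLoop_fract (s : ℝ) : boundaryLoop (Int.fract s) = boundaryLoop s := by
  ext1
  rw [coe_boundaryLoop, coe_boundaryLoop, circlePoint_fract]

theorem norm_boundaryLoop (s : ℝ) : ‖(boundaryLoop s : Fin 2 → ℝ)‖ = 1 := by
  have := norm_ne_zero_iff.2 (circlePoint_ne_zero s)
  rw [coe_boundaryLoop, norm_smul, norm_inv, norm_norm, inv_mul_cancel₀ this]

theorem continuous_circlePoint : Continuous circlePoint := by
  refine continuous_pi fun i => ?_
  fin_cases i <;> simp [circlePoint] <;> fun_prop

theorem continuous_boundaryLoop : Continuous boundaryLoop :=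
  Continuous.subtype_mk ((continuous_circlePoint.norm.inv₀
    fun s => norm_ne_zero_iff.2 (circlePoint_ne_zero s)).smul continuous_circlePoint) _

theorem turnAngle_smul_circlePoint {r : ℝ} (hr : 0 < r) (s : ℝ) :
    turnAngle (r • circlePoint s) = Int.fract s := by
  have hz : (⟨(r • circlePoint s) 0, (r • circlePoint s) 1⟩ : ℂ) =
      r * (Real.cos (2 * Real.pi * s) + Real.sin (2 * Real.pi * s) * Complex.I) := by
    apply Complex.ext <;>
      simp [circlePoint, -Complex.ofReal_cos, -Complex.ofReal_sin, -Complex.ofReal_mul]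
  have h := Complex.arg_mul_cos_add_sin_mul_I_coe_angle hr ((2 * Real.pi * s : ℝ) : Real.Angle)
  simp only [Real.Angle.cos_coe, Real.Angle.sin_coe] at h
  rw [← hz, Real.Angle.angle_eq_iff_two_pi_dvd_sub] at h
  obtain ⟨k, hk⟩ := h
  rw [turnAngle, Int.fract_eq_fract]
  refine ⟨k, ?_⟩
  have hpi := Real.pi_ne_zero
  field_simp
  linarith

theorem turnAngle_smul_boundaryLoop {r : ℝ} (hr : 0 < r) (s : ℝ) :
    turnAngle (r • (boundaryLoop s : Fin 2 → ℝ)) = Int.fract s := by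
  rw [coe_boundaryLoop, smul_smul, turnAngle_smul_circlePoint]
  exact mul_pos hr (inv_pos.2 (norm_pos_iff.2 (circlePoint_ne_zero s)))

theorem turnAngle_boundaryLoop (s : ℝ) :
    turnAngle (boundaryLoop s : Fin 2 → ℝ) = Int.fract s := by
  simpa using turnAngle_smul_boundaryLoop one_pos s

theorem norm_smul_boundaryLoop_turnAngle (y : Fin 2 → ℝ) :
    ‖y‖ • (boundaryLoop (turnAngle y) : Fin 2 → ℝ) = y := by
  set z : ℂ := ⟨y 0, y 1⟩ with hz
  have hy : y = ‖z‖ • circlePoint (turnAngle y) := by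
    rw [turnAngle, circlePoint_fract, circlePoint, mul_div_cancel₀ _ (by positivity)]
    ext i
    fin_cases i
    · simp [← hz, Complex.norm_mul_cos_arg]
      rfl
    · simp [← hz, Complex.norm_mul_sin_arg]
      rfl
  have h0 := norm_ne_zero_iff.2 (circlePoint_ne_zero (turnAngle y))
  have hn : ‖y‖ = ‖z‖ * ‖circlePoint (turnAngle y)‖ := by
    conv_lhs => rw [hy]
    rw [norm_smul, norm_norm]
  rw [coe_boundaryLoop, smul_smul, hn, mul_assoc, mul_inv_cancel₀ h0, mul_one, ← hy]

theorem turnAngle_mem (y : Fin 2 → ℝ) : turnAngle y ∈ unitInterval :=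
  ⟨Int.fract_nonneg _, (Int.fract_lt_one _).le⟩

/-- Polar coordinates on the closed `2`-cell. -/
noncomputable def polar (p : unitInterval × unitInterval) : ClosedCube 2 :=
  ⟨(p.1 : ℝ) • (boundaryLoop (p.2 : ℝ) : Fin 2 → ℝ), by
    rw [mem_closedBall_zero_iff, norm_smul, norm_boundaryLoop, mul_one, Real.norm_eq_abs,
      abs_of_nonneg p.1.2.1]
    exact p.1.2.2⟩

theorem norm_polar (p : unitInterval × unitInterval) : ‖(polar p : Fin 2 → ℝ)‖ = p.1 := by
  rw [polar, norm_smul, norm_boundaryLoop, mul_one, Real.norm_eq_abs, abs_of_nonneg p.1.2.1]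

theorem turnAngle_polar (p : unitInterval × unitInterval) (h : (p.1 : ℝ) ≠ 0) :
    turnAngle (polar p : Fin 2 → ℝ) = Int.fract (p.2 : ℝ) :=
  turnAngle_smul_boundaryLoop (lt_of_le_of_ne p.1.2.1 h.symm) _

theorem polar_of_eq_one (p : unitInterval × unitInterval) (h : (p.1 : ℝ) = 1) :
    polar p = boundaryLoop (p.2 : ℝ) := by
  ext1
  simp [polar, h]

/-- A continuous map from a compact space to a Hausdorff space is closed. Openness and continuity on
a 2-cell can therefore be tested in the coordinates `(r, s)`, where the angle has no branch cut. -/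
theorem isQuotientMap_polar : IsQuotientMap polar := by
  have hc : Continuous polar := Continuous.subtype_mk
    ((continuous_subtype_val.comp continuous_fst).smul (continuous_subtype_val.comp
      (continuous_boundaryLoop.comp (continuous_subtype_val.comp continuous_snd)))) _
  refine hc.isClosedMap.isQuotientMap hc fun y => ?_
  refine ⟨(⟨‖(y : Fin 2 → ℝ)‖, norm_nonneg _, mem_closedBall_zero_iff.1 y.2⟩,
    ⟨turnAngle y, turnAngle_mem _⟩), ?_⟩
  ext1
  exact norm_smul_boundaryLoop_turnAngle _

theorem norm_fin_one (x : Fin 1 → ℝ) : ‖x‖ = |x 0| := by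
  rw [← Real.norm_eq_abs, Pi.norm_def]
  simp

theorem coe_edgePath (ε : ℤˣ) (t : unitInterval) :
    (edgePath ε t : Fin 1 → ℝ) 0 = ((ε : ℤ) : ℝ) * (2 * (t : ℝ) - 1) := rfl

/-! ### Functions and topology on the one-vertex complex -/

namespace SignedArrangement

variable {L : Type u} (A : SignedArrangement L)

/-- The value at the point with parameter `s` (for `0 ≤ s < k`) on the boundary of the `2`-cell of
a context with `k` elements of a function that is given on the `1`-cells. -/
noncomputable def boundaryValue {γ : Type w} (c : γ) (φ : L → ℝ → γ) (C : A.Context) (s : ℝ) : γ :=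
  match (A.order C)[⌊s⌋₊]? with
  | some a => φ a (((A.sign C a : ℤ) : ℝ) * (2 * Int.fract s - 1))
  | none => c

open Classical in
/-- A function on the one-vertex complex, given on the open cells. -/
noncomputable def singDesc {γ : Type w} (c : γ) (φ : L → ℝ → γ) (ψ : A.Context → (Fin 2 → ℝ) → γ)
    (h₁ : ∀ a, φ a 1 = c) (h₂ : ∀ a, φ a (-1) = c) : A.Sing → γ :=
  Quot.lift (Sum.elim (fun _ => c) (Sum.elim (fun p => φ p.1 ((p.2 : Fin 1 → ℝ) 0)) fun p =>
    if ‖(p.2 : Fin 2 → ℝ)‖ < 1 then ψ p.1 p.2 else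
      A.boundaryValue c φ p.1 ((A.order p.1).length * turnAngle (p.2 : Fin 2 → ℝ)))) (by
    have hpm : ∀ a x, |x| = 1 → φ a x = c := by
      intro a x hx
      rcases (abs_eq zero_le_one).1 hx with rfl | rfl
      exacts [h₁ a, h₂ a]
    have hend : ∀ a (ε : ℤˣ) t, t = 0 ∨ t = 1 → φ a (((ε : ℤ) : ℝ) * (2 * t - 1)) = c := by
      intro a ε t ht
      apply hpm
      rcases Int.units_eq_one_or ε with rfl | rfl <;> rcases ht with rfl | rfl <;> norm_num
    rintro _ _ (⟨a, x, hx⟩ | ⟨C, i, t⟩ | ⟨C, hC, x, hx⟩)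
    · exact hpm _ _ (by rw [← norm_fin_one, hx])
    · simp only [Sum.elim_inr, Sum.elim_inl, norm_boundaryLoop, lt_irrefl, if_false,
        turnAngle_boundaryLoop, coe_edgePath]
      have hk : (0 : ℝ) < (A.order C).length := by
        exact_mod_cast (Nat.zero_le _).trans_lt i.2
      have ht0 := t.2.1
      have hi : ((i : ℕ) : ℝ) + 1 ≤ (A.order C).length := by exact_mod_cast i.2
      rcases eq_or_lt_of_le t.2.2 with ht | ht
      · rw [hend _ _ _ (Or.inr ht), ht]
        -- At the end of the last segment the parameter wraps around from `k` to `0`. In either case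
        -- it is an integer, where the value is that of the vertex.
        have hint : ∃ n : ℕ, (A.order C).length * Int.fract
            (((i : ℕ) + (1 : ℝ)) / (A.order C).length) = n := by
          rcases eq_or_lt_of_le hi with h | h
          · exact ⟨0, by rw [h, div_self hk.ne']; simp⟩
          · refine ⟨i + 1, ?_⟩
            rw [Int.fract_eq_self.2 ⟨by positivity, (div_lt_one hk).2 h⟩]
            push_cast
            field_simp
        obtain ⟨n, hn⟩ := hint
        rw [hn, boundaryValue]
        split
        · exact hend _ _ _ (Or.inl (by simp))
        · rfl
      · rw [Int.fract_eq_self.2 ⟨by positivity, (div_lt_one hk).2 (by linarith)⟩,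
          mul_div_cancel₀ _ hk.ne', boundaryValue]
        have h1 : ⌊((i : ℕ) : ℝ) + (t : ℝ)⌋₊ = i := by
          rw [Nat.floor_eq_iff (by positivity)]
          constructor <;> linarith
        have h2 : Int.fract (((i : ℕ) : ℝ) + (t : ℝ)) = t := by
          rw [Int.fract_natCast_add, Int.fract_eq_self.2 ⟨ht0, ht⟩]
        rw [h1, h2, List.getElem?_eq_getElem i.2]
        rfl
    · simp [hx, boundaryValue, hC])

section Desc

variable {γ : Type w} (c : γ) (φ : L → ℝ → γ) (ψ : A.Context → (Fin 2 → ℝ) → γ)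
    (h₁ : ∀ a, φ a 1 = c) (h₂ : ∀ a, φ a (-1) = c)

@[simp] theorem singDesc_edge (a : L) (x : ClosedCube 1) :
    A.singDesc c φ ψ h₁ h₂ (A.singEdge a x) = φ a ((x : Fin 1 → ℝ) 0) := rfl

theorem singDesc_face (C : A.Context) (x : ClosedCube 2) (hx : ‖(x : Fin 2 → ℝ)‖ < 1) :
    A.singDesc c φ ψ h₁ h₂ (A.singFace C x) = ψ C x := if_pos hx

end Desc

theorem singEdge_of_norm_eq_one (a : L) (x : ClosedCube 1) (hx : ‖(x : Fin 1 → ℝ)‖ = 1) :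
    A.singEdge a x = A.singVertex := Quot.sound (.edge a x hx)

theorem singEdge_edgePath_zero (a : L) (ε : ℤˣ) : A.singEdge a (edgePath ε 0) = A.singVertex := by
  refine A.singEdge_of_norm_eq_one a _ ?_
  rw [norm_fin_one, coe_edgePath]
  rcases Int.units_eq_one_or ε with rfl | rfl <;> norm_num

theorem singEdge_edgePath_one (a : L) (ε : ℤˣ) : A.singEdge a (edgePath ε 1) = A.singVertex := by
  refine A.singEdge_of_norm_eq_one a _ ?_
  rw [norm_fin_one, coe_edgePath]
  rcases Int.units_eq_one_or ε with rfl | rfl <;> norm_num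

theorem singFace_boundaryLoop (C : A.Context) (i : Fin (A.order C).length) (t : unitInterval) :
    A.singFace C (boundaryLoop (((i : ℕ) + (t : ℝ)) / (A.order C).length)) =
      A.singEdge ((A.order C).get i) (edgePath (A.sign C ((A.order C).get i)) t) :=
  Quot.sound (.face C i t)

/-- Together with the next lemma this describes the attaching map: non-integral values of `k * s`
lie in open 1-cells and integral ones go to the vertex. An empty context falls under the integral
case, as then `k * s = 0`. -/
theorem singFace_boundaryLoop_of_not_int (C : A.Context) (s : unitInterval)
    (hs : ((A.order C).length * s : ℝ) ∉ Set.range ((↑) : ℤ → ℝ)) :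
    ∃ (i : Fin (A.order C).length) (t : unitInterval), 0 < (t : ℝ) ∧ (t : ℝ) < 1 ∧
      ((A.order C).length * s : ℝ) = (i : ℕ) + t ∧
      A.singFace C (boundaryLoop s) =
        A.singEdge ((A.order C).get i) (edgePath (A.sign C ((A.order C).get i)) t) := by
  set k := (A.order C).length with hk
  have hu0 : (0 : ℝ) ≤ k * s := mul_nonneg (Nat.cast_nonneg _) s.2.1
  have hk0 : (0 : ℝ) < k := by
    rcases Nat.eq_zero_or_pos k with h | h
    · exact absurd ⟨0, by simp [h]⟩ hs
    · exact_mod_cast h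
  have hle : (k * s : ℝ) ≤ k := mul_le_of_le_one_right hk0.le s.2.2
  have hlt : (k * s : ℝ) < k := lt_of_le_of_ne hle fun h => hs ⟨k, by rw [h]; simp⟩
  have hfl : ⌊(k * s : ℝ)⌋₊ < k := (Nat.floor_lt hu0).2 hlt
  have h1 := Nat.floor_le hu0
  have h2 := Nat.lt_floor_add_one (k * s : ℝ)
  refine ⟨⟨_, hfl⟩, ⟨(k * s : ℝ) - ⌊(k * s : ℝ)⌋₊, by linarith, by linarith⟩, ?_, ?_, ?_, ?_⟩
  · refine lt_of_le_of_ne (by simpa using h1) fun h => hs ⟨⌊(k * s : ℝ)⌋₊, ?_⟩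
    simp only at h
    push_cast
    linarith
  · simp only
    linarith
  · simp [← hk]
  · rw [← singFace_boundaryLoop]
    congr 2
    simp only [add_sub_cancel]
    rw [← hk]
    field_simp

theorem singFace_boundaryLoop_of_int (C : A.Context) (s : unitInterval)
    (hs : ((A.order C).length * s : ℝ) ∈ Set.range ((↑) : ℤ → ℝ)) :
    A.singFace C (boundaryLoop s) = A.singVertex := by
  rcases Nat.eq_zero_or_pos (A.order C).length with h | h
  · exact Quot.sound (.face_nil C (List.length_eq_zero_iff.1 h) _ (norm_boundaryLoop _))
  obtain ⟨n, hn⟩ := hs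
  have hk : (0 : ℝ) < (A.order C).length := by exact_mod_cast h
  have h0 : 0 ≤ n := by
    have : (0 : ℝ) ≤ n := by rw [hn]; exact mul_nonneg hk.le s.2.1
    exact_mod_cast this
  lift n to ℕ using h0
  have h1 : n ≤ (A.order C).length := by
    have : ((n : ℤ) : ℝ) ≤ (A.order C).length := by
      rw [hn]; exact mul_le_of_le_one_right hk.le s.2.2
    exact_mod_cast this
  push_cast at hn
  rcases n with _ | n
  · have := A.singFace_boundaryLoop C ⟨0, h⟩ 0
    rw [singEdge_edgePath_zero] at this
    rw [← this]
    congr 2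
    have : (s : ℝ) = 0 := by simpa [hk.ne'] using hn.symm
    simp [this]
  · have := A.singFace_boundaryLoop C ⟨n, h1⟩ 1
    rw [singEdge_edgePath_one] at this
    rw [← this]
    congr 2
    push_cast at hn
    simp only [Set.Icc.coe_one, hn]
    field_simp

theorem continuous_singEdge (a : L) : Continuous (A.singEdge a) :=
  continuous_quot_mk.comp (continuous_inr.comp (continuous_inl.comp continuous_sigmaMk))

theorem continuous_singFace (C : A.Context) : Continuous (A.singFace C) :=
  continuous_quot_mk.comp (continuous_inr.comp (continuous_inr.comp continuous_sigmaMk))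

theorem isOpen_sing_iff {S : Set A.Sing} : IsOpen S ↔
    (∀ a, IsOpen (A.singEdge a ⁻¹' S)) ∧ ∀ C, IsOpen ((A.singFace C ∘ polar) ⁻¹' S) := by
  constructor
  · exact fun h => ⟨fun a => h.preimage (A.continuous_singEdge a),
      fun C => h.preimage ((A.continuous_singFace C).comp isQuotientMap_polar.continuous)⟩
  · rintro ⟨h1, h2⟩
    have : IsOpen (Quot.mk A.Glue ⁻¹' S) := by
      rw [isOpen_sum_iff, isOpen_sum_iff, isOpen_sigma_iff, isOpen_sigma_iff]
      refine ⟨isOpen_discrete _, fun a => h1 a, fun C => ?_⟩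
      rw [← isQuotientMap_polar.isOpen_preimage]
      exact h2 C
    exact this

theorem continuousOn_sing {γ : Type w} [TopologicalSpace γ] {f : A.Sing → γ} {S : Set A.Sing}
    (hS : IsOpen S) (h1 : ∀ a, ContinuousOn (f ∘ A.singEdge a) (A.singEdge a ⁻¹' S))
    (h2 : ∀ C, ContinuousOn (f ∘ A.singFace C ∘ polar) ((A.singFace C ∘ polar) ⁻¹' S)) :
    ContinuousOn f S := by
  rw [continuousOn_open_iff hS]
  intro t ht
  obtain ⟨hS1, hS2⟩ := A.isOpen_sing_iff.1 hS
  exact A.isOpen_sing_iff.2 ⟨fun a => (h1 a).isOpen_inter_preimage (hS1 a) ht,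
    fun C => (h2 C).isOpen_inter_preimage (hS2 C) ht⟩

theorem sing_cases {P : A.Sing → Prop} (hv : P A.singVertex) (he : ∀ a x, P (A.singEdge a x))
    (hf : ∀ C x, P (A.singFace C x)) (x : A.Sing) : P x := by
  rcases x with ⟨(_ | ⟨a, x⟩ | ⟨C, x⟩)⟩
  exacts [hv, he a x, hf C x]

end SignedArrangement

/-! ### Local constancy of floor and round -/

theorem ContinuousOn.int_floor {T : Type v} [TopologicalSpace T] {f : T → ℝ} {S : Set T}
    (hf : ContinuousOn f S) (h : ∀ x ∈ S, f x ∉ Set.range ((↑) : ℤ → ℝ)) :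
    ContinuousOn (fun x => ⌊f x⌋) S := by
  intro x hx
  have hlt : (⌊f x⌋ : ℝ) < f x := lt_of_le_of_ne (Int.floor_le _) fun e => h x hx ⟨_, e⟩
  refine (continuousWithinAt_const (b := ⌊f x⌋)).congr_of_eventuallyEq ?_ rfl
  filter_upwards [(hf x hx).eventually (Ioo_mem_nhds hlt (Int.lt_floor_add_one _))] with y hy
  exact Int.floor_eq_iff.2 ⟨hy.1.le, hy.2⟩

theorem ContinuousOn.int_round {T : Type v} [TopologicalSpace T] {f : T → ℝ} {S : Set T}
    (hf : ContinuousOn f S) (h : ∀ x ∈ S, f x - 1 / 2 ∉ Set.range ((↑) : ℤ → ℝ)) :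
    ContinuousOn (fun x => round (f x)) S := by
  simp only [round_eq]
  refine (hf.add continuousOn_const).int_floor fun x hx => ?_
  rintro ⟨n, hn⟩
  rw [Pi.add_apply] at hn
  exact h x hx ⟨n - 1, by push_cast; linarith⟩

/-- The two sides differ by the integer `k * ⌊s⌋`. This translates conditions on `turnAngle` into
conditions on the polar coordinate. -/
theorem mul_fract_sub_mem_range_int_iff (k : ℕ) (s b : ℝ) :
    k * Int.fract s - b ∈ Set.range ((↑) : ℤ → ℝ) ↔ k * s - b ∈ Set.range ((↑) : ℤ → ℝ) := by
  have h : k * Int.fract s = k * s - (k * ⌊s⌋ : ℤ) := by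
    rw [Int.fract]; push_cast; ring
  constructor
  · rintro ⟨n, hn⟩
    exact ⟨n + k * ⌊s⌋, by rw [h] at hn; push_cast at hn ⊢; linarith⟩
  · rintro ⟨n, hn⟩
    exact ⟨n - k * ⌊s⌋, by rw [h]; push_cast; linarith⟩

theorem isOpen_setOf_sub_notMem_range_int {T : Type v} [TopologicalSpace T] {f : T → ℝ}
    (hf : Continuous f) (b : ℝ) : IsOpen {x | f x - b ∉ Set.range ((↑) : ℤ → ℝ)} :=
  (Int.isClosedEmbedding_coe_real.isClosed_range.preimage (hf.sub continuous_const)).isOpen_compl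

/-! ### Open stars of the barycentric subdivision -/

namespace SignedArrangement

variable {L : Type u} (A : SignedArrangement L)

/-- The three kinds of open stars in the barycentric subdivision of a `2`-complex. -/
inductive StarKind
  | vertex
  | edge
  | face

/-- The union of the open stars of a given kind. -/
def openStar : StarKind → Set A.Sing
  | .vertex => {x | A.singDesc True (fun _ x => x ≠ 0) (fun C y => y ≠ 0 ∧
      (A.order C).length * turnAngle y - 1 / 2 ∉ Set.range ((↑) : ℤ → ℝ)) (by simp) (by simp) x}
  | .edge => {x | A.singDesc False (fun _ x => |x| < 1) (fun C y => y ≠ 0 ∧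
      (A.order C).length * turnAngle y - 0 ∉ Set.range ((↑) : ℤ → ℝ)) (by simp) (by simp) x}
  | .face => {x | A.singDesc False (fun _ _ => False) (fun _ _ => True) (by simp) (by simp) x}

theorem singVertex_mem_openStar : A.singVertex ∈ A.openStar .vertex := trivial

theorem singVertex_notMem_openStar_edge : A.singVertex ∉ A.openStar .edge := id

theorem singEdge_mem_openStar_vertex_iff {a : L} {x : ClosedCube 1} :
    A.singEdge a x ∈ A.openStar .vertex ↔ (x : Fin 1 → ℝ) 0 ≠ 0 := Iff.rfl

theorem singEdge_mem_openStar_edge_iff {a : L} {x : ClosedCube 1} :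
    A.singEdge a x ∈ A.openStar .edge ↔ |(x : Fin 1 → ℝ) 0| < 1 := Iff.rfl

theorem singEdge_notMem_openStar_face {a : L} {x : ClosedCube 1} :
    A.singEdge a x ∉ A.openStar .face := id

theorem polar_ne_zero_iff (p : unitInterval × unitInterval) :
    (polar p : Fin 2 → ℝ) ≠ 0 ↔ (p.1 : ℝ) ≠ 0 := by
  rw [← norm_ne_zero_iff, norm_polar]

theorem singFace_mem_openStar_face_iff {C : A.Context} {y : ClosedCube 2} :
    A.singFace C y ∈ A.openStar .face ↔ ‖(y : Fin 2 → ℝ)‖ < 1 := by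
  constructor
  · intro h
    by_contra hy
    have hy1 : ‖(y : Fin 2 → ℝ)‖ = 1 :=
      le_antisymm (mem_closedBall_zero_iff.1 y.2) (not_lt.1 hy)
    obtain ⟨p, rfl⟩ := isQuotientMap_polar.surjective y
    rw [norm_polar] at hy1
    rw [polar_of_eq_one p hy1] at h
    by_cases hs : ((A.order C).length * (p.2 : ℝ) : ℝ) ∈ Set.range ((↑) : ℤ → ℝ)
    · rw [A.singFace_boundaryLoop_of_int C _ hs] at h
      exact h
    · obtain ⟨i, t, -, -, -, e⟩ := A.singFace_boundaryLoop_of_not_int C _ hs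
      rw [e] at h
      exact h
  · intro h
    simp only [openStar, Set.mem_ofPred_eq, A.singDesc_face _ _ _ _ _ C y h]

theorem polar_mem_openStar_face_iff {C : A.Context} {p : unitInterval × unitInterval} :
    A.singFace C (polar p) ∈ A.openStar .face ↔ (p.1 : ℝ) < 1 := by
  rw [singFace_mem_openStar_face_iff, norm_polar]

/-- For `r < 1` this is the definition. At `r = 1` it is compatibility with the gluing: the
parameter `i + t` is a half-integer exactly when `t = 1 / 2`, the midpoint of the 1-cell for either
sign. -/
theorem polar_mem_openStar_vertex_iff {C : A.Context} {p : unitInterval × unitInterval} :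
    A.singFace C (polar p) ∈ A.openStar .vertex ↔ (p.1 : ℝ) ≠ 0 ∧
      (A.order C).length * (p.2 : ℝ) - 1 / 2 ∉ Set.range ((↑) : ℤ → ℝ) := by
  rcases lt_or_eq_of_le p.1.2.2 with h | h
  · simp only [openStar, Set.mem_ofPred_eq]
    rw [A.singDesc_face _ _ _ _ _ C _ (by rwa [norm_polar]), polar_ne_zero_iff]
    refine and_congr_right fun h0 => ?_
    rw [turnAngle_polar p h0, mul_fract_sub_mem_range_int_iff]
  · rw [polar_of_eq_one p h]
    simp only [h, ne_eq, one_ne_zero, not_false_eq_true, true_and]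
    by_cases hs : ((A.order C).length * (p.2 : ℝ) : ℝ) ∈ Set.range ((↑) : ℤ → ℝ)
    · rw [A.singFace_boundaryLoop_of_int C _ hs]
      refine iff_of_true A.singVertex_mem_openStar ?_
      rintro ⟨n, hn⟩
      obtain ⟨m, hm⟩ := hs
      rw [← hm] at hn
      have : ((2 * (m - n) : ℤ) : ℝ) = (1 : ℤ) := by push_cast; linarith
      have := Int.cast_injective this
      omega
    · obtain ⟨i, t, h0, h1, hst, e⟩ := A.singFace_boundaryLoop_of_not_int C _ hs
      rw [e, singEdge_mem_openStar_vertex_iff, coe_edgePath, hst]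
      rw [not_iff_not.symm, not_not, not_not]
      constructor
      · intro h2
        have : 2 * (t : ℝ) - 1 = 0 := by
          rcases Int.units_eq_one_or (A.sign C ((A.order C).get i)) with h | h <;> rw [h] at h2 <;>
            push_cast at h2 <;> linarith
        exact ⟨i, by push_cast; linarith⟩
      · rintro ⟨n, hn⟩
        have hlt : ((n - i : ℤ) : ℝ) < (1 : ℤ) := by push_cast; linarith
        have hgt : ((-1 : ℤ) : ℝ) < (n - i : ℤ) := by push_cast; linarith
        have hlt' := Int.cast_lt.1 hlt
        have hgt' := Int.cast_lt.1 hgt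
        have hni : n = i := by omega
        rw [hni] at hn
        push_cast at hn
        have : 2 * (t : ℝ) - 1 = 0 := by linarith
        rw [this, mul_zero]

theorem polar_mem_openStar_edge_iff {C : A.Context} {p : unitInterval × unitInterval} :
    A.singFace C (polar p) ∈ A.openStar .edge ↔ (p.1 : ℝ) ≠ 0 ∧
      (A.order C).length * (p.2 : ℝ) - 0 ∉ Set.range ((↑) : ℤ → ℝ) := by
  rcases lt_or_eq_of_le p.1.2.2 with h | h
  · simp only [openStar, Set.mem_ofPred_eq]
    rw [A.singDesc_face _ _ _ _ _ C _ (by rwa [norm_polar]), polar_ne_zero_iff]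
    refine and_congr_right fun h0 => ?_
    rw [turnAngle_polar p h0, mul_fract_sub_mem_range_int_iff]
  · rw [polar_of_eq_one p h, sub_zero]
    simp only [h, ne_eq, one_ne_zero, not_false_eq_true, true_and]
    by_cases hs : ((A.order C).length * (p.2 : ℝ) : ℝ) ∈ Set.range ((↑) : ℤ → ℝ)
    · rw [A.singFace_boundaryLoop_of_int C _ hs]
      exact iff_of_false A.singVertex_notMem_openStar_edge (not_not.2 hs)
    · obtain ⟨i, t, h0, h1, hst, e⟩ := A.singFace_boundaryLoop_of_not_int C _ hs
      rw [e, singEdge_mem_openStar_edge_iff, coe_edgePath]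
      refine iff_of_true ?_ hs
      rcases Int.units_eq_one_or (A.sign C ((A.order C).get i)) with h | h <;> rw [h, abs_lt] <;>
        push_cast <;> constructor <;> linarith

theorem isOpen_openStar (i : StarKind) : IsOpen (A.openStar i) := by
  have hr : Continuous fun p : unitInterval × unitInterval => (p.1 : ℝ) := by fun_prop
  have hx : Continuous fun x : ClosedCube 1 => (x : Fin 1 → ℝ) 0 :=
    (continuous_apply 0).comp continuous_subtype_val
  have hk : ∀ k : ℕ, Continuous fun p : unitInterval × unitInterval => (k : ℝ) * (p.2 : ℝ) := by
    fun_prop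
  rw [isOpen_sing_iff]
  rcases i with _ | _ | _
  · refine ⟨fun a => isOpen_ne_fun hx continuous_const, fun C => ?_⟩
    convert! (isOpen_ne_fun hr continuous_const).inter
      (isOpen_setOf_sub_notMem_range_int (hk (A.order C).length) (1 / 2)) using 1
    ext p
    exact A.polar_mem_openStar_vertex_iff
  · refine ⟨fun a => isOpen_lt hx.abs continuous_const, fun C => ?_⟩
    convert! (isOpen_ne_fun hr continuous_const).inter
      (isOpen_setOf_sub_notMem_range_int (hk (A.order C).length) 0) using 1
    ext p
    exact A.polar_mem_openStar_edge_iff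
  · refine ⟨fun a => ?_, fun C => ?_⟩
    · convert! isOpen_empty using 1
    · convert! isOpen_lt hr continuous_const using 1
      ext p
      exact A.polar_mem_openStar_face_iff

end SignedArrangement

/-! ### Transition functions and the holonomy bundle -/

namespace SignedArrangement

variable {L : Type u} (A : SignedArrangement L)

section Bundle

variable {G : Type w} [Group G] (h : L → G)

/-- The word of a context in a group, for given values of the labels. -/
def word (C : A.Context) : List G := (A.order C).map fun a => h a ^ (A.sign C a : ℤ)

/-- The product of the first `n` letters of the word of a context. -/
def prefixProd (C : A.Context) (n : ℤ) : G := ((A.word h C).take n.toNat).prod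

/-- The value of the starting point of the `n`-th edge in the boundary of a `2`-cell, as
transported along the boundary. -/
def edgeStart (C : A.Context) (n : ℤ) : G :=
  match (A.order C)[n.toNat]? with
  | some a => if A.sign C a = 1 then A.prefixProd h C n else A.prefixProd h C (n + 1)
  | none => 1

theorem prefixProd_zero (C : A.Context) : A.prefixProd h C 0 = 1 := by simp [prefixProd]

theorem prefixProd_length (C : A.Context) :
    A.prefixProd h C (A.order C).length = (A.word h C).prod := by
  rw [prefixProd, Int.toNat_natCast, List.take_of_length_le (by simp [word])]

theorem prefixProd_succ (C : A.Context) (i : Fin (A.order C).length) :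
    A.prefixProd h C ((i : ℕ) + 1) = A.prefixProd h C (i : ℕ) *
      h ((A.order C).get i) ^ (A.sign C ((A.order C).get i) : ℤ) := by
  have hi : (i : ℕ) < (A.word h C).length := by simp [word]
  have e : ((i : ℕ) + 1 : ℤ).toNat = (i : ℕ) + 1 := by omega
  rw [prefixProd, e, List.prod_take_succ _ _ hi, prefixProd, Int.toNat_natCast]
  simp [word]

theorem edgeStart_get (C : A.Context) (i : Fin (A.order C).length) :
    A.edgeStart h C (i : ℕ) = if A.sign C ((A.order C).get i) = 1 then A.prefixProd h C (i : ℕ)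
      else A.prefixProd h C ((i : ℕ) + 1) := by
  simp [edgeStart]

open Classical in
/-- The transition from the trivialization over the open cells to the one over the open stars of a
given kind. -/
noncomputable def starShift : StarKind → A.Sing → G
  | .vertex => A.singDesc 1 (fun a x => if 0 < x ∧ x < 1 then h a else 1)
      (fun C y => A.prefixProd h C (round ((A.order C).length * turnAngle y))) (by simp)
      (by norm_num)
  | .edge => A.singDesc 1 (fun _ _ => 1)
      (fun C y => A.edgeStart h C ⌊(A.order C).length * turnAngle y⌋) (by simp) (by simp)
  | .face => fun _ => 1

theorem starShift_edge_singEdge (a : L) (x : ClosedCube 1) :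
    A.starShift h .edge (A.singEdge a x) = 1 := rfl

open Classical in
theorem starShift_vertex_singEdge (a : L) (x : ClosedCube 1) :
    A.starShift h .vertex (A.singEdge a x) =
      if 0 < (x : Fin 1 → ℝ) 0 ∧ (x : Fin 1 → ℝ) 0 < 1 then h a else 1 := rfl

theorem starShift_edge_polar (C : A.Context) (p : unitInterval × unitInterval)
    (h0 : (p.1 : ℝ) ≠ 0) (h1 : (p.1 : ℝ) < 1)
    (hs : (A.order C).length * (p.2 : ℝ) - 0 ∉ Set.range ((↑) : ℤ → ℝ)) :
    A.starShift h .edge (A.singFace C (polar p)) =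
      A.edgeStart h C ⌊(A.order C).length * (p.2 : ℝ)⌋ := by
  rw [starShift, singDesc_face _ _ _ _ _ _ _ _ (by rwa [norm_polar]), turnAngle_polar p h0]
  rcases lt_or_eq_of_le p.2.2.2 with h2 | h2
  · rw [Int.fract_eq_self.2 ⟨p.2.2.1, h2⟩]
  · exact absurd ⟨(A.order C).length, by rw [h2]; simp⟩ hs

/-- The rays `s = 0` and `s = 1` are the same in the cell, but rounding gives the empty prefix on
one and the whole word on the other. They agree because the word is trivial; this is what makes the
bundle extend over the 2-cells. -/
theorem starShift_vertex_polar (hw : ∀ C, (A.word h C).prod = 1) (C : A.Context)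
    (p : unitInterval × unitInterval) (h0 : (p.1 : ℝ) ≠ 0) (h1 : (p.1 : ℝ) < 1) :
    A.starShift h .vertex (A.singFace C (polar p)) =
      A.prefixProd h C (round ((A.order C).length * (p.2 : ℝ))) := by
  rw [starShift, singDesc_face _ _ _ _ _ _ _ _ (by rwa [norm_polar]), turnAngle_polar p h0]
  rcases lt_or_eq_of_le p.2.2.2 with h2 | h2
  · rw [Int.fract_eq_self.2 ⟨p.2.2.1, h2⟩]
  · rw [h2, Int.fract_one, mul_zero, mul_one, round_zero, round_natCast, prefixProd_zero,
      prefixProd_length, hw]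

/-- The individual shifts jump at the boundary of a 2-cell, but their quotient does not. At `r = 1`
it is `h a` on the positive half of the 1-cell and `1` on the negative half. The comparison with
prefixes splits by the half of the segment and by the sign of the label. -/
theorem starShift_edge_vertex_polar (hw : ∀ C, (A.word h C).prod = 1) (C : A.Context)
    (p : unitInterval × unitInterval) (h0 : (p.1 : ℝ) ≠ 0)
    (hs : (A.order C).length * (p.2 : ℝ) - 0 ∉ Set.range ((↑) : ℤ → ℝ))
    (hs' : (A.order C).length * (p.2 : ℝ) - 1 / 2 ∉ Set.range ((↑) : ℤ → ℝ)) :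
    (A.starShift h .edge (A.singFace C (polar p)))⁻¹ *
      A.starShift h .vertex (A.singFace C (polar p)) =
      (A.edgeStart h C ⌊(A.order C).length * (p.2 : ℝ)⌋)⁻¹ *
        A.prefixProd h C (round ((A.order C).length * (p.2 : ℝ))) := by
  rcases lt_or_eq_of_le p.1.2.2 with h1 | h1
  · rw [A.starShift_edge_polar h C p h0 h1 hs, A.starShift_vertex_polar h hw C p h0 h1]
  rw [polar_of_eq_one p h1]
  rw [sub_zero] at hs
  obtain ⟨i, t, ht0, ht1, hst, e⟩ := A.singFace_boundaryLoop_of_not_int C _ hs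
  rw [e, hst, starShift_edge_singEdge, starShift_vertex_singEdge, inv_one, one_mul, coe_edgePath]
  have hfl : ⌊((i : ℕ) : ℝ) + (t : ℝ)⌋ = (i : ℕ) := by
    rw [Int.floor_eq_iff]; push_cast; constructor <;> linarith
  rw [hfl, edgeStart_get]
  have hne : (t : ℝ) ≠ 1 / 2 := fun ht => hs' ⟨i, by rw [hst, ht]; push_cast; ring⟩
  have hsucc := A.prefixProd_succ h C i
  rcases lt_or_gt_of_ne hne with ht | ht
  · have hr : round (((i : ℕ) : ℝ) + (t : ℝ)) = (i : ℕ) := by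
      rw [round_eq, Int.floor_eq_iff]; push_cast; constructor <;> linarith
    rw [hr]
    rcases Int.units_eq_one_or (A.sign C ((A.order C).get i)) with hε | hε <;> rw [hε] at hsucc ⊢
    · rw [if_neg (by push_cast; rintro ⟨h, -⟩; linarith), if_pos rfl, inv_mul_cancel]
    · rw [if_pos (by push_cast; constructor <;> linarith), if_neg (by decide), hsucc]
      simp
  · have hr : round (((i : ℕ) : ℝ) + (t : ℝ)) = (i : ℕ) + 1 := by
      rw [round_eq, Int.floor_eq_iff]; push_cast; constructor <;> linarith
    rw [hr]
    rcases Int.units_eq_one_or (A.sign C ((A.order C).get i)) with hε | hε <;> rw [hε] at hsucc ⊢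
    · rw [if_pos (by push_cast; constructor <;> linarith), if_pos rfl, hsucc]
      simp
    · rw [if_neg (by push_cast; rintro ⟨h, -⟩; linarith), if_neg (by decide), inv_mul_cancel]

variable [TopologicalSpace G]

/-- The transition is locally constant: on a 1-cell it depends only on the half, and on a 2-cell
only on a floor and a rounding whose jumps lie outside the two stars. -/
theorem continuousOn_starShift_edge_vertex (hw : ∀ C, (A.word h C).prod = 1) :
    ContinuousOn (fun x => (A.starShift h .edge x)⁻¹ * A.starShift h .vertex x)
      (A.openStar .edge ∩ A.openStar .vertex) := by
  refine A.continuousOn_sing ((A.isOpen_openStar _).inter (A.isOpen_openStar _)) (fun a => ?_)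
    fun C => ?_
  · intro x hx
    have hx1 := A.singEdge_mem_openStar_edge_iff.1 hx.1
    have hx0 := A.singEdge_mem_openStar_vertex_iff.1 hx.2
    have hc : Continuous fun x : ClosedCube 1 => (x : Fin 1 → ℝ) 0 :=
      (continuous_apply 0).comp continuous_subtype_val
    rw [abs_lt] at hx1
    refine (continuousWithinAt_const (b := if 0 < (x : Fin 1 → ℝ) 0 then h a else 1)
      ).congr_of_eventuallyEq_of_mem ?_ hx
    rcases lt_or_gt_of_ne hx0 with h0 | h0
    · filter_upwards [mem_nhdsWithin_of_mem_nhds ((isOpen_lt hc continuous_const).mem_nhds h0)]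
        with y hy
      have hy : (y : Fin 1 → ℝ) 0 < 0 := hy
      simp [starShift_edge_singEdge, starShift_vertex_singEdge, hy.not_gt, h0.not_gt]
    · filter_upwards [mem_nhdsWithin_of_mem_nhds ((isOpen_lt continuous_const hc).mem_nhds h0),
        mem_nhdsWithin_of_mem_nhds ((isOpen_lt hc continuous_const).mem_nhds hx1.2)] with y hy hy1
      have hy : 0 < (y : Fin 1 → ℝ) 0 := hy
      have hy1 : (y : Fin 1 → ℝ) 0 < 1 := hy1
      simp [starShift_edge_singEdge, starShift_vertex_singEdge, hy, hy1, h0]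
  · have hk : Continuous fun p : unitInterval × unitInterval =>
      ((A.order C).length : ℝ) * (p.2 : ℝ) := by fun_prop
    refine ContinuousOn.congr ((continuous_of_discreteTopology
      (f := fun q : ℤ × ℤ => (A.edgeStart h C q.1)⁻¹ * A.prefixProd h C q.2)).comp_continuousOn
        ((hk.continuousOn.int_floor fun p hp => ?_).prodMk
          (hk.continuousOn.int_round fun p hp => ?_))) fun p hp => ?_
    · simpa using (A.polar_mem_openStar_edge_iff.1 hp.1).2
    · exact (A.polar_mem_openStar_vertex_iff.1 hp.2).2
    · exact A.starShift_edge_vertex_polar h hw C p (A.polar_mem_openStar_edge_iff.1 hp.1).1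
        (A.polar_mem_openStar_edge_iff.1 hp.1).2 (A.polar_mem_openStar_vertex_iff.1 hp.2).2

theorem continuousOn_starShift_face_vertex (hw : ∀ C, (A.word h C).prod = 1) :
    ContinuousOn (fun x => (A.starShift h .face x)⁻¹ * A.starShift h .vertex x)
      (A.openStar .face ∩ A.openStar .vertex) := by
  refine A.continuousOn_sing ((A.isOpen_openStar _).inter (A.isOpen_openStar _)) (fun a x hx => ?_)
    fun C => ?_
  · exact absurd hx.1 A.singEdge_notMem_openStar_face
  · have hk : Continuous fun p : unitInterval × unitInterval =>
      ((A.order C).length : ℝ) * (p.2 : ℝ) := by fun_prop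
    refine ContinuousOn.congr
      ((continuous_of_discreteTopology (f := A.prefixProd h C)).comp_continuousOn
        (hk.continuousOn.int_round fun p hp => ?_)) fun p hp => ?_
    · exact (A.polar_mem_openStar_vertex_iff.1 hp.2).2
    · have h0 := (A.polar_mem_openStar_vertex_iff.1 hp.2).1
      have h1 := A.polar_mem_openStar_face_iff.1 hp.1
      change (1 : G)⁻¹ * _ = _
      rw [inv_one, one_mul]
      exact A.starShift_vertex_polar h hw C p h0 h1

theorem continuousOn_starShift_face_edge :
    ContinuousOn (fun x => (A.starShift h .face x)⁻¹ * A.starShift h .edge x)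
      (A.openStar .face ∩ A.openStar .edge) := by
  refine A.continuousOn_sing ((A.isOpen_openStar _).inter (A.isOpen_openStar _)) (fun a x hx => ?_)
    fun C => ?_
  · exact absurd hx.1 A.singEdge_notMem_openStar_face
  · have hk : Continuous fun p : unitInterval × unitInterval =>
      ((A.order C).length : ℝ) * (p.2 : ℝ) := by fun_prop
    refine ContinuousOn.congr
      ((continuous_of_discreteTopology (f := A.edgeStart h C)).comp_continuousOn
        (hk.continuousOn.int_floor fun p hp => ?_)) fun p hp => ?_
    · simpa using (A.polar_mem_openStar_edge_iff.1 hp.2).2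
    · have h0 := A.polar_mem_openStar_edge_iff.1 hp.2
      have h1 := A.polar_mem_openStar_face_iff.1 hp.1
      change (1 : G)⁻¹ * _ = _
      rw [inv_one, one_mul]
      exact A.starShift_edge_polar h C p h0.1 h1 h0.2

variable [DiscreteTopology G]

theorem continuousOn_starShift (hw : ∀ C, (A.word h C).prod = 1) (i j : StarKind) :
    ContinuousOn (fun x => (A.starShift h i x)⁻¹ * A.starShift h j x)
      (A.openStar i ∩ A.openStar j) := by
  have hsymm : ∀ i j, ContinuousOn (fun x => (A.starShift h i x)⁻¹ * A.starShift h j x)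
      (A.openStar i ∩ A.openStar j) →
      ContinuousOn (fun x => (A.starShift h j x)⁻¹ * A.starShift h i x)
        (A.openStar j ∩ A.openStar i) := by
    intro i j hij
    rw [Set.inter_comm]
    refine (hij.inv).congr fun x _ => ?_
    simp
  have hself : ∀ i, ContinuousOn (fun x => (A.starShift h i x)⁻¹ * A.starShift h i x)
      (A.openStar i ∩ A.openStar i) := fun i => by simpa using continuousOn_const
  have hev := A.continuousOn_starShift_edge_vertex h hw
  have hfv := A.continuousOn_starShift_face_vertex h hw
  have hfe := A.continuousOn_starShift_face_edge h
  cases i <;> cases j <;> first | exact hself _ | assumption | (apply hsymm; assumption)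

theorem exists_mem_openStar (x : A.Sing) : ∃ i, x ∈ A.openStar i := by
  refine A.sing_cases (P := fun x => ∃ i, x ∈ A.openStar i)
    ⟨.vertex, A.singVertex_mem_openStar⟩ (fun a x => ?_) (fun C y => ?_) x
  · by_cases hx : (x : Fin 1 → ℝ) 0 = 0
    · exact ⟨.edge, A.singEdge_mem_openStar_edge_iff.2 (by simp [hx])⟩
    · exact ⟨.vertex, hx⟩
  · obtain ⟨p, rfl⟩ := isQuotientMap_polar.surjective y
    rcases lt_or_eq_of_le p.1.2.2 with h1 | h1
    · exact ⟨.face, A.polar_mem_openStar_face_iff.2 h1⟩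
    by_cases hs : (A.order C).length * (p.2 : ℝ) - 0 ∈ Set.range ((↑) : ℤ → ℝ)
    · rw [sub_zero] at hs
      refine ⟨.vertex, ?_⟩
      rw [polar_of_eq_one p h1, A.singFace_boundaryLoop_of_int C _ hs]
      exact A.singVertex_mem_openStar
    · exact ⟨.edge, A.polar_mem_openStar_edge_iff.2 ⟨by simp [h1], hs⟩⟩

/-- The bundle with fibre a discrete group `G` over the one-vertex complex whose monodromy along
the loop of a label `a` is right multiplication by `h a`. -/
noncomputable def holonomyBundle (hw : ∀ C, (A.word h C).prod = 1) :
    FiberBundleCore StarKind A.Sing G where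
  baseSet := A.openStar
  isOpen_baseSet := A.isOpen_openStar
  indexAt x := (A.exists_mem_openStar x).choose
  mem_baseSet_at x := (A.exists_mem_openStar x).choose_spec
  -- The transitions are quotients of shifts, so the cocycle identity is automatic; only their
  -- continuity depends on the words being trivial.
  coordChange i j x g := g * ((A.starShift h i x)⁻¹ * A.starShift h j x)
  coordChange_self i x _ g := by simp
  continuousOn_coordChange i j :=
    (continuous_of_discreteTopology (f := fun q : G × G => q.1 * q.2)).comp_continuousOn
      (continuousOn_snd.prodMk ((A.continuousOn_starShift h hw i j).comp continuousOn_fst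
        fun _ hp => hp.1))
  coordChange_comp i j k x _ g := by group

end Bundle

end SignedArrangement

/-! ### Path lifting and potentials -/

namespace SignedArrangement

variable {L : Type u} (A : SignedArrangement L)

section Bundle

variable {G : Type w} [Group G] (h : L → G) [TopologicalSpace G] [DiscreteTopology G]
  (hw : ∀ C, (A.word h C).prod = 1)

/-- The point of the holonomy bundle over `b` with coordinate `g` in the trivialization over the
open cells. -/
noncomputable def holonomyPoint (b : A.Sing) (g : G) : (A.holonomyBundle h hw).TotalSpace :=
  ⟨b, g * A.starShift h ((A.holonomyBundle h hw).indexAt b) b⟩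

/-- The coordinate of a point of the holonomy bundle in the trivialization over the open cells. -/
noncomputable def holonomyCoord (p : (A.holonomyBundle h hw).TotalSpace) : G :=
  (show G from p.2) * (A.starShift h ((A.holonomyBundle h hw).indexAt p.1) p.1)⁻¹

theorem holonomyPoint_holonomyCoord (p : (A.holonomyBundle h hw).TotalSpace) :
    A.holonomyPoint h hw p.1 (A.holonomyCoord h hw p) = p := by
  rw [holonomyPoint, holonomyCoord]
  congr 1
  exact inv_mul_cancel_right (G := G) _ _

theorem holonomyCoord_holonomyPoint (b : A.Sing) (g : G) :
    A.holonomyCoord h hw (A.holonomyPoint h hw b g) = g :=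
  mul_inv_cancel_right (G := G) _ _

theorem localTriv_holonomyPoint (i : StarKind) (b : A.Sing) (g : G) :
    (A.holonomyBundle h hw).localTriv i (A.holonomyPoint h hw b g) =
      (b, g * A.starShift h i b) := by
  rw [FiberBundleCore.localTriv_apply]
  refine Prod.ext rfl ?_
  change (g * A.starShift h ((A.holonomyBundle h hw).indexAt b) b) *
    ((A.starShift h ((A.holonomyBundle h hw).indexAt b) b)⁻¹ * A.starShift h i b) = _
  group

theorem continuous_edgePath (ε : ℤˣ) : Continuous (edgePath ε) := by
  refine Continuous.subtype_mk (continuous_pi fun _ => ?_) _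
  fun_prop

-- This is the explicit lift of the loop of `a`, which exhibits its monodromy. The coordinate over
-- open cells jumps at `t = 1`. In the chart of the vertex star it is `g` before the midpoint and `g
-- * h a` after it, up to and including the end point; the chart of the edge star bridges the
-- midpoint.
open Classical in
theorem continuous_holonomyPoint_edgePath (a : L) (g : G) :
    Continuous fun t : unitInterval => A.holonomyPoint h hw (A.singEdge a (edgePath 1 t))
      (if t = 1 then g * h a else g) := by
  have hproj : Continuous fun t : unitInterval => A.singEdge a (edgePath 1 t) :=
    (A.continuous_singEdge a).comp (continuous_edgePath 1)
  have hcoe : Continuous fun t : unitInterval => (t : ℝ) := continuous_subtype_val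
  rw [continuous_iff_continuousAt]
  intro t₀
  rcases lt_trichotomy (t₀ : ℝ) (1 / 2) with ht | ht | ht
  · refine Bundle.Trivialization.continuousAt_of_comp_left ((A.holonomyBundle h hw).localTriv .vertex)
      hproj.continuousAt ?_ ?_
    · refine A.singEdge_mem_openStar_vertex_iff.2 ?_
      rw [coe_edgePath]
      push_cast
      intro h0
      linarith
    · refine (hproj.prodMk (continuous_const (y := g))).continuousAt.congr ?_
      filter_upwards [(isOpen_lt hcoe continuous_const).mem_nhds ht] with t htt
      have htt : (t : ℝ) < 1 / 2 := htt
      have h1 : t ≠ 1 := fun e => by rw [e, Set.Icc.coe_one] at htt; linarith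
      rw [Function.comp_apply, localTriv_holonomyPoint, starShift_vertex_singEdge, if_neg h1,
        if_neg, mul_one]
      rw [coe_edgePath]
      push_cast
      intro h0
      linarith
  · refine Bundle.Trivialization.continuousAt_of_comp_left ((A.holonomyBundle h hw).localTriv .edge)
      hproj.continuousAt ?_ ?_
    · refine A.singEdge_mem_openStar_edge_iff.2 ?_
      rw [coe_edgePath, ht]
      norm_num
    · refine (hproj.prodMk (continuous_const (y := g))).continuousAt.congr ?_
      have ht1 : (t₀ : ℝ) < 1 := by linarith
      filter_upwards [(isOpen_lt hcoe continuous_const).mem_nhds ht1] with t htt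
      have htt : (t : ℝ) < 1 := htt
      have h1 : t ≠ 1 := fun e => by rw [e, Set.Icc.coe_one] at htt; linarith
      rw [Function.comp_apply, localTriv_holonomyPoint, starShift_edge_singEdge, if_neg h1,
        mul_one]
  · refine Bundle.Trivialization.continuousAt_of_comp_left ((A.holonomyBundle h hw).localTriv .vertex)
      hproj.continuousAt ?_ ?_
    · refine A.singEdge_mem_openStar_vertex_iff.2 ?_
      rw [coe_edgePath]
      push_cast
      intro h0
      linarith
    · refine (hproj.prodMk (continuous_const (y := g * h a))).continuousAt.congr ?_
      filter_upwards [(isOpen_lt continuous_const hcoe).mem_nhds ht] with t htt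
      have htt : 1 / 2 < (t : ℝ) := htt
      rw [Function.comp_apply, localTriv_holonomyPoint, starShift_vertex_singEdge, coe_edgePath]
      push_cast
      by_cases h1 : t = 1
      · rw [if_pos h1, if_neg (by rw [h1, Set.Icc.coe_one]; norm_num), mul_one]
      · have h2 : (t : ℝ) < 1 := lt_of_le_of_ne t.2.2 fun e => h1 (Subtype.ext e)
        rw [if_neg h1, if_pos (by constructor <;> linarith)]

theorem isCoveringMap_holonomyBundle : IsCoveringMap (A.holonomyBundle h hw).proj :=
  FiberBundle.isCoveringMap

end Bundle

/-- A labelling of the edges of a simply connected complex over the one-vertex complex by elements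
of a group in which the words of all contexts are trivial is a coboundary. -/
theorem exists_potential {X : Type v} [TopologicalSpace X] [SimplyConnectedSpace X]
    (f : C(X, A.Sing)) {G : Type w} [Group G] (h : L → G) (hw : ∀ C, (A.word h C).prod = 1) :
    ∃ V : X → G, ∀ (a : L) (x y : X) (γ : Path x y),
      (∀ t, f (γ t) = A.singEdge a (edgePath 1 t)) → V y = V x * h a := by
  classical
  let _ : TopologicalSpace G := ⊥
  have : DiscreteTopology G := ⟨rfl⟩
  have cov := A.isCoveringMap_holonomyBundle h hw
  obtain ⟨x₀⟩ : Nonempty X := inferInstance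
  let e₀ : (A.holonomyBundle h hw).proj ⁻¹' {f x₀} := ⟨A.holonomyPoint h hw (f x₀) 1, rfl⟩
  -- The potential at `x` is the coordinate of the end point of the lift along a path from `x₀` to
  -- `x`.
  let q : ∀ x, Path.Homotopic.Quotient x₀ x := fun x => .mk (PathConnectedSpace.somePath x₀ x)
  let e : ∀ x, (A.holonomyBundle h hw).proj ⁻¹' {f x} := fun x => cov.monodromy ((q x).map f) e₀
  refine ⟨fun x => A.holonomyCoord h hw (e x).1, fun a x y γ hγ => ?_⟩
  -- Simple connectedness: the chosen path to `y` is homotopic to the one to `x` followed by `γ`.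
  have hq : q y = (q x).trans (.mk γ) := Subsingleton.elim _ _
  have he : e y = cov.monodromy ((Path.Homotopic.Quotient.mk γ).map f) (e x) := by
    change cov.monodromy ((q y).map f) e₀ = _
    have hm : (q y).map f = ((q x).map f).trans ((Path.Homotopic.Quotient.mk γ).map f) := by
      rw [hq]
      simp only [q, ← Path.Homotopic.Quotient.mk_trans, ← Path.Homotopic.Quotient.mk_map,
        Path.map_trans]
    rw [hm, cov.monodromy_trans_apply]
  set g := A.holonomyCoord h hw (e x).1 with hg
  have hex : ((e x).1).1 = f x := (e x).2
  let Γ : C(unitInterval, (A.holonomyBundle h hw).TotalSpace) :=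
    ⟨_, A.continuous_holonomyPoint_edgePath h hw a g⟩
  have h0 : (γ.map f.continuous).toContinuousMap 0 = (A.holonomyBundle h hw).proj (e x).1 :=
    (γ.map f.continuous).source.trans hex.symm
  -- By uniqueness of lifts, the lift along `γ` is the explicit one, whose end point is known.
  have hΓ : Γ = cov.liftPath (γ.map f.continuous).toContinuousMap (e x).1 h0 := by
    rw [cov.eq_liftPath_iff']
    refine ⟨funext fun t => (hγ t).symm, ?_⟩
    change A.holonomyPoint h hw (A.singEdge a (edgePath 1 0)) 
      (if (0 : unitInterval) = 1 then _ else _) = _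
    rw [if_neg zero_ne_one, ← hγ, γ.source, hg]
    exact (congrArg (A.holonomyPoint h hw · _) hex.symm).trans
      (A.holonomyPoint_holonomyCoord h hw _)
  have hey : (e y).1 = Γ 1 := by
    rw [he, hΓ]
    rfl
  change A.holonomyCoord h hw (e y).1 = g * h a
  rw [hey]
  change A.holonomyCoord h hw (A.holonomyPoint h hw _ (if (1 : unitInterval) = 1 then _ else _)) = _
  rw [if_pos rfl, holonomyCoord_holonomyPoint]

end SignedArrangement

/-! ### Incidence numbers are well defined -/

theorem ContinuousMap.eq_of_forall_exists_int {T : Type v} [TopologicalSpace T]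
    [PreconnectedSpace T] {f : C(T, ℝ)} (hf : ∀ t, ∃ k : ℤ, f t = k) (s t : T) : f s = f t := by
  have hr : ∀ t, f t = (round (f t) : ℝ) := fun t => by
    obtain ⟨k, hk⟩ := hf t
    rw [hk, round_intCast]
  have hc : Continuous fun t => round (f t) := by
    refine continuousOn_univ.1 (f.continuous.continuousOn.int_round fun t _ => ?_)
    obtain ⟨k, hk⟩ := hf t
    rintro ⟨n, hn⟩
    rw [hk] at hn
    have : ((2 * (k - n) : ℤ) : ℝ) = (1 : ℤ) := by push_cast; linarith
    have := Int.cast_injective this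
    omega
  rw [hr s, hr t, PreconnectedSpace.constant inferInstance hc (x := s) (y := t)]

section Incidence

variable {X : Type v} [TopologicalSpace X] [CWComplex (Set.univ : Set X)]

/-- Two lifts of the same loop in the circle differ by a continuous integer-valued function, which
is constant. Hence the chosen value of `incidence` can be computed from any lift. -/
theorem IsIncidence.unique {e : RelCWComplex.cell (Set.univ : Set X) 2}
    {a : RelCWComplex.cell (Set.univ : Set X) 1} {m n : ℤ} (hm : IsIncidence e a m)
    (hn : IsIncidence e a n) : m = n := by
  obtain ⟨f, hf1, hf2, hf⟩ := hm
  obtain ⟨g, hg1, hg2, hg⟩ := hn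
  have hint : ∀ t, ∃ k : ℤ, (f - g) t = k := by
    intro t
    by_cases ht : (RelCWComplex.map 2 e (boundaryLoop (t : ℝ)) : X) ∈ RelCWComplex.openCell 1 a
    · obtain ⟨x, hx, hxt⟩ := ht
      obtain ⟨k, hk⟩ := hf1 t x hx hxt.symm
      obtain ⟨l, hl⟩ := hg1 t x hx hxt.symm
      exact ⟨k - l, by rw [ContinuousMap.sub_apply, hk, hl]; push_cast; ring⟩
    · obtain ⟨k, hk⟩ := hf2 t ht
      obtain ⟨l, hl⟩ := hg2 t ht
      exact ⟨k - l, by rw [ContinuousMap.sub_apply, hk, hl]; push_cast; ring⟩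
  have h := ContinuousMap.eq_of_forall_exists_int hint 1 0
  rw [ContinuousMap.sub_apply, ContinuousMap.sub_apply] at h
  have : (m : ℝ) = n := by rw [← hf, ← hg]; linarith
  exact_mod_cast this

theorem IsIncidence.incidence_eq {e : RelCWComplex.cell (Set.univ : Set X) 2}
    {a : RelCWComplex.cell (Set.univ : Set X) 1} {m : ℤ} (hm : IsIncidence e a m) :
    incidence e a = m := by
  have h : ∃ m, IsIncidence e a m := ⟨m, hm⟩
  rw [incidence, dif_pos h]
  exact h.choose_spec.unique hm

end Incidence

/-! ### Attaching maps and incidence numbers of a topological realization -/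

namespace SignedArrangement

variable {L : Type u} (A : SignedArrangement L)

theorem singEdge_injOn {a b : L} {x y : ClosedCube 1} (hx : |(x : Fin 1 → ℝ) 0| < 1)
    (h : A.singEdge a x = A.singEdge b y) : a = b ∧ x = y := by
  classical
  let F : A.Sing → Option (L × ℝ) := A.singDesc none
    (fun a x => if |x| < 1 then some (a, x) else none) (fun _ _ => none) (by simp) (by simp)
  have hF : F (A.singEdge a x) = F (A.singEdge b y) := by rw [h]
  simp only [F, singDesc_edge, if_pos hx] at hF
  split_ifs at hF with hy
  simp only [Option.some.injEq, Prod.mk.injEq] at hF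
  refine ⟨hF.1, Subtype.ext (funext fun i => ?_)⟩
  rw [Subsingleton.elim i 0, hF.2]

theorem abs_edgePath_lt_one (ε : ℤˣ) {t : unitInterval} (h0 : 0 < (t : ℝ)) (h1 : (t : ℝ) < 1) :
    |(edgePath ε t : Fin 1 → ℝ) 0| < 1 := by
  rw [coe_edgePath, abs_lt]
  rcases Int.units_eq_one_or ε with h | h <;> rw [h] <;> push_cast <;> constructor <;> linarith

namespace TopologicalRealization

variable {A} {X : Type v} [TopologicalSpace X] [T2Space X] [CWComplex (Set.univ : Set X)]
  (R : A.TopologicalRealization X)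

-- Every point of `X` lies in an open cell. A vertex maps to the vertex and an open 2-cell maps into
-- the open face star, so only a 1-cell can reach an interior point of a 1-cell; there the label and
-- the parameter are determined.
include R in
theorem eq_map_of_toSing_eq {p : X} {a : RelCWComplex.cell (Set.univ : Set X) 1} {x : ClosedCube 1}
    (hx : |(x : Fin 1 → ℝ) 0| < 1) (h : R.toSing p = A.singEdge (R.edgeLabel a) x) :
    p = RelCWComplex.map 1 a x := by
  have hp : p ∈ ⋃ (n : ℕ) (j : RelCWComplex.cell (Set.univ : Set X) n),
      RelCWComplex.openCell n j := by
    rw [CWComplex.iUnion_openCell_eq_complex]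
    trivial
  simp only [Set.mem_iUnion] at hp
  obtain ⟨n, j, y, hy, rfl⟩ := hp
  have hy' := Metric.ball_subset_closedBall hy
  match n, j, y, hy, hy', h with
  | 0, j, y, hy, hy', h =>
    rw [R.toSing_vertex j ⟨y, hy'⟩] at h
    exact absurd (h ▸ A.singEdge_mem_openStar_edge_iff.2 hx) A.singVertex_notMem_openStar_edge
  | 1, j, y, hy, hy', h =>
    rw [R.toSing_edge j ⟨y, hy'⟩] at h
    obtain ⟨h1, h2⟩ := A.singEdge_injOn hx h.symm
    rw [R.edgeLabel.injective h1, h2]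
  | 2, j, y, hy, hy', h =>
    rw [R.toSing_face j ⟨y, hy'⟩] at h
    refine absurd ?_ (A.singEdge_notMem_openStar_face (a := R.edgeLabel a) (x := x))
    rw [← h, singFace_mem_openStar_face_iff]
    simpa using hy
  | n + 3, j, _, _, _, _ => exact ((R.dim_le_two (n + 3) (by omega)).false j).elim

omit [T2Space X] in
theorem continuous_map (n : ℕ) (j : RelCWComplex.cell (Set.univ : Set X) n) :
    Continuous fun x : ClosedCube n => RelCWComplex.map n j x :=
  continuousOn_iff_continuous_domRestrict.1 (RelCWComplex.continuousOn n j)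

/-- Interior points of a 1-cell have a unique preimage in `X`, so the attaching map in `Sing`
determines the one in `X` for `0 < t < 1`. The end points follow by density, since `X` is Hausdorff.
-/
theorem map_boundaryLoop (e : RelCWComplex.cell (Set.univ : Set X) 2)
    {C : A.Context} (hC : R.faceLabel e = C) (i : Fin (A.order C).length) (t : unitInterval) :
    RelCWComplex.map 2 e
        (boundaryLoop (((i : ℕ) + (t : ℝ)) / (A.order C).length)) =
      RelCWComplex.map 1 (R.edgeLabel.symm ((A.order C).get i))
        (edgePath (A.sign C ((A.order C).get i)) t) := by
  have hdense : Dense (Set.univ \ {0, 1} : Set unitInterval) :=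
    dense_univ.sdiff_finite (Set.toFinite _)
  have h1 : Continuous fun t : unitInterval =>
      (RelCWComplex.map 2 e (boundaryLoop (((i : ℕ) + (t : ℝ)) / (A.order C).length)) : X) :=
    (continuous_map 2 e).comp (continuous_boundaryLoop.comp (by fun_prop))
  have h2 : Continuous fun t : unitInterval =>
      (RelCWComplex.map 1 (R.edgeLabel.symm ((A.order C).get i)) (edgePath (A.sign C ((A.order C).get i)) t) : X) :=
    (continuous_map 1 _).comp (continuous_edgePath _)
  refine congrFun (h1.ext_on hdense h2 fun t ht => ?_) t
  simp only [Set.mem_sdiff, Set.mem_univ, Set.mem_insert_iff, Set.mem_singleton_iff, not_or,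
    true_and] at ht
  have h0 : 0 < (t : ℝ) := lt_of_le_of_ne t.2.1 fun h => ht.1 (Subtype.ext h.symm)
  have h1 : (t : ℝ) < 1 := lt_of_le_of_ne t.2.2 fun h => ht.2 (Subtype.ext h)
  refine R.eq_map_of_toSing_eq (abs_edgePath_lt_one _ h0 h1) ?_
  rw [R.toSing_face, hC, singFace_boundaryLoop, Equiv.apply_symm_apply]

theorem order_nodup (C : A.Context) : (A.order C).Nodup := by
  rw [← Multiset.coe_nodup, A.order_spec]
  exact C.1.nodup

theorem mem_order_iff (C : A.Context) (a : L) : a ∈ A.order C ↔ a ∈ C.1 := by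
  rw [← Multiset.mem_coe, A.order_spec, Finset.mem_val]

/-- Where the attaching map of a `2`-cell meets an open `1`-cell. -/
theorem exists_of_map_boundaryLoop_eq {e : RelCWComplex.cell (Set.univ : Set X) 2}
    {C : A.Context} (hC : R.faceLabel e = C) {a : RelCWComplex.cell (Set.univ : Set X) 1} {t : unitInterval} {x : Fin 1 → ℝ}
    (hx : x ∈ Metric.ball (0 : Fin 1 → ℝ) 1)
    (h : RelCWComplex.map 2 e (boundaryLoop (t : ℝ)) = RelCWComplex.map 1 a x) :
    ∃ (i : Fin (A.order C).length) (s : unitInterval), 0 < (s : ℝ) ∧ (s : ℝ) < 1 ∧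
      ((A.order C).length * t : ℝ) = (i : ℕ) + s ∧
      (A.order C).get i = R.edgeLabel a ∧
      (edgePath (A.sign C ((A.order C).get i)) s : Fin 1 → ℝ) = x := by
  have hx' := Metric.ball_subset_closedBall hx
  have hx1 : |x 0| < 1 := by rwa [← norm_fin_one, ← mem_ball_zero_iff]
  have h' := congrArg R.toSing h
  rw [R.toSing_face, hC, R.toSing_edge a ⟨x, hx'⟩] at h'
  by_cases hs : ((A.order C).length * (t : ℝ) : ℝ) ∈ Set.range ((↑) : ℤ → ℝ)
  · rw [A.singFace_boundaryLoop_of_int _ _ hs] at h'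
    exact absurd (h' ▸ A.singEdge_mem_openStar_edge_iff.2 hx1) A.singVertex_notMem_openStar_edge
  · obtain ⟨i, s, h0, h1, hst, e'⟩ := A.singFace_boundaryLoop_of_not_int _ _ hs
    rw [e'] at h'
    obtain ⟨h2, h3⟩ := A.singEdge_injOn (abs_edgePath_lt_one _ h0 h1) h'
    exact ⟨i, s, h0, h1, hst, h2, congrArg Subtype.val h3⟩

/-- A label occurs only once in a context, so the loop obtained by collapsing runs around the circle
once, in the direction of the sign. -/
theorem isIncidence_get (e : RelCWComplex.cell (Set.univ : Set X) 2)
    {C : A.Context} (hC : R.faceLabel e = C) (i : Fin (A.order C).length) :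
    IsIncidence e (R.edgeLabel.symm ((A.order C).get i))
      (A.sign C ((A.order C).get i)) := by
  -- The lift is `0` before the `i`-th segment, a ramp of height `±1` along it, and constant
  -- afterwards.
  refine ⟨⟨fun t => ((A.sign C ((A.order C).get i) : ℤ) : ℝ) * max 0 (min ((A.order C).length * (t : ℝ) - (i : ℕ)) 1), by fun_prop⟩,
    fun t x hx h => ?_, fun t h => ?_, ?_⟩
  · obtain ⟨j, s, h0, h1, hst, hj, hs⟩ := R.exists_of_map_boundaryLoop_eq hC hx h
    rw [Equiv.apply_symm_apply] at hj
    have hji : j = i := (order_nodup C).injective_get hj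
    subst hji
    rw [← hs, coe_edgePath]
    have hst' : ((A.order C).length * (t : ℝ) - (j : ℕ) : ℝ) = s := by
      rw [sub_eq_iff_eq_add, add_comm]; exact hst
    simp only [ContinuousMap.coe_mk, hst', min_eq_left h1.le, max_eq_right h0.le]
    rcases Int.units_eq_one_or (A.sign C ((A.order C).get j)) with hε | hε <;> rw [hε]
    · exact ⟨0, by push_cast; ring⟩
    -- Traversed backwards, the circle coordinate is `1 - s` while the lift is `-s`.
    · exact ⟨-1, by push_cast; ring⟩
  · suffices ∃ n : ℤ, max 0 (min ((A.order C).length * (t : ℝ) - (i : ℕ)) 1) = n by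
      obtain ⟨n, hn⟩ := this
      exact ⟨A.sign C ((A.order C).get i) * n, by simp only [ContinuousMap.coe_mk, hn]; push_cast; ring⟩
    by_cases hs : ((A.order C).length * (t : ℝ) : ℝ) ∈ Set.range ((↑) : ℤ → ℝ)
    · obtain ⟨n, hn⟩ := hs
      exact ⟨max 0 (min (n - (i : ℕ)) 1), by rw [← hn]; push_cast; rfl⟩
    · obtain ⟨j, s, h0, h1, hst, hsing⟩ := A.singFace_boundaryLoop_of_not_int C t hs
      have hst' : ((A.order C).length * (t : ℝ) : ℝ) = (j : ℕ) + s := hst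
      rcases lt_trichotomy (j : ℕ) (i : ℕ) with hji | hji | hji
      · refine ⟨0, ?_⟩
        have : ((j : ℕ) : ℝ) + 1 ≤ (i : ℕ) := by exact_mod_cast hji
        rw [hst', min_eq_left (by linarith), max_eq_left (by linarith), Int.cast_zero]
      · exfalso
        have hji' : j = i := Fin.ext hji
        subst hji'
        apply h
        rw [R.eq_map_of_toSing_eq (p := RelCWComplex.map 2 e (boundaryLoop (t : ℝ)))
          (a := R.edgeLabel.symm ((A.order C).get j)) (abs_edgePath_lt_one _ h0 h1)
          (by rw [R.toSing_face, hC, hsing, Equiv.apply_symm_apply])]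
        refine Set.mem_image_of_mem _ ?_
        rw [mem_ball_zero_iff, norm_fin_one]
        exact abs_edgePath_lt_one _ h0 h1
      · refine ⟨1, ?_⟩
        have : ((i : ℕ) : ℝ) + 1 ≤ (j : ℕ) := by exact_mod_cast hji
        rw [hst', min_eq_right (by linarith), max_eq_right zero_le_one, Int.cast_one]
  · have hik : ((i : ℕ) : ℝ) + 1 ≤ (A.order C).length := by exact_mod_cast i.2
    have hi0 : (0 : ℝ) ≤ (i : ℕ) := Nat.cast_nonneg _
    simp only [ContinuousMap.coe_mk, Set.Icc.coe_one, Set.Icc.coe_zero]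
    rw [min_eq_right (by linarith), min_eq_left (by linarith), max_eq_right zero_le_one,
      max_eq_left (by linarith)]
    ring

theorem isIncidence_of_notMem {e : RelCWComplex.cell (Set.univ : Set X) 2}
    {a : RelCWComplex.cell (Set.univ : Set X) 1} (ha : R.edgeLabel a ∉ (R.faceLabel e).1) :
    IsIncidence e a 0 := by
  refine ⟨0, fun t x hx h => ?_, fun t h => ⟨0, by simp⟩, by simp⟩
  obtain ⟨i, -, -, -, -, hi, -⟩ := R.exists_of_map_boundaryLoop_eq rfl hx h
  exact absurd ((mem_order_iff _ _).1 (hi ▸ List.get_mem _ _)) ha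

open Classical in
theorem incidence_eq (e : RelCWComplex.cell (Set.univ : Set X) 2)
    (a : RelCWComplex.cell (Set.univ : Set X) 1) :
    incidence e a = if R.edgeLabel a ∈ (R.faceLabel e).1 then
      (A.sign (R.faceLabel e) (R.edgeLabel a) : ℤ) else 0 := by
  split_ifs with ha
  · obtain ⟨i, hi⟩ := List.mem_iff_get.1 ((mem_order_iff _ _).2 ha)
    have := (R.isIncidence_get e rfl i).incidence_eq
    rwa [hi, Equiv.symm_apply_apply] at this
  · exact (R.isIncidence_of_notMem ha).incidence_eq

end TopologicalRealization

end SignedArrangement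

/-! ### From projective to scalar labellings -/

namespace SignedArrangement

variable {L : Type u} {A : SignedArrangement L}

theorem word_map {G H : Type*} [Group G] [Group H] (f : G →* H) (T : L → G) (C : A.Context) :
    (A.word (fun a => f (T a)) C).prod = f (A.word T C).prod := by
  rw [map_list_prod, word, word, List.map_map]
  simp [Function.comp_def]

theorem word_prod_eq_prod {K : Type*} [CommGroup K] (z : L → K) (C : A.Context) :
    (A.word z C).prod = ∏ a ∈ C.1, z a ^ (A.sign C a : ℤ) := by
  rw [Finset.prod, ← A.order_spec C, Multiset.map_coe, Multiset.prod_coe, word]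

namespace TopologicalRealization

variable {X : Type v} [TopologicalSpace X] [T2Space X] [CWComplex (Set.univ : Set X)]
  (R : A.TopologicalRealization X)

/-- The initial point of the edge with a given label. -/
def source (a : L) : X := RelCWComplex.map 1 (R.edgeLabel.symm a) (edgePath 1 0)

/-- The final point of the edge with a given label. -/
def target (a : L) : X := RelCWComplex.map 1 (R.edgeLabel.symm a) (edgePath 1 1)

theorem edgePath_neg_one_zero : edgePath (-1) 0 = edgePath 1 1 := by
  refine Subtype.ext (funext fun i => ?_)
  simp only [edgePath]
  norm_num

theorem edgePath_neg_one_one : edgePath (-1) 1 = edgePath 1 0 := by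
  refine Subtype.ext (funext fun i => ?_)
  simp only [edgePath]
  norm_num

/-- The path along the edge with a given label. -/
def path (a : L) : Path (R.source a) (R.target a) where
  toFun t := RelCWComplex.map 1 (R.edgeLabel.symm a) (edgePath 1 t)
  continuous_toFun := (continuous_map 1 _).comp (continuous_edgePath 1)
  source' := rfl
  target' := rfl

theorem toSing_path (a : L) (t : unitInterval) :
    R.toSing (R.path a t) = A.singEdge a (edgePath 1 t) := by
  change R.toSing (RelCWComplex.map 1 (R.edgeLabel.symm a) (edgePath 1 t)) = _
  rw [R.toSing_edge, Equiv.apply_symm_apply]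

include R in
/-- Changing a labelling of the edges by a coboundary and by central elements changes the products
along the contexts only by the central elements. -/
theorem prod_word_of_eq_mul {G : Type w} [Group G] {T z : L → G}
    (hz : ∀ a, z a ∈ Subgroup.center G) (V : X → G)
    (hT : ∀ a, T a = z a * ((V (R.source a))⁻¹ * V (R.target a))) (C : A.Context) :
    (A.word T C).prod = (A.word z C).prod := by
  obtain ⟨e, rfl⟩ := R.faceLabel.surjective C
  generalize hC : R.faceLabel e = C
  let p : ℕ → X := fun n => RelCWComplex.map 2 e (boundaryLoop ((n : ℝ) / (A.order C).length))
  -- Telescoping along the boundary of the 2-cell: after `n` segments the coboundary part depends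
  -- only on the first and the current corner.
  have hp : ∀ n ≤ (A.order C).length, A.prefixProd T C n =
      A.prefixProd z C n * ((V (p 0))⁻¹ * V (p n)) := by
    intro n
    induction n with
    | zero => simp [prefixProd_zero]
    | succ n ih =>
      intro hn
      let i : Fin (A.order C).length := ⟨n, hn⟩
      have h0 := R.map_boundaryLoop e hC i 0
      have h1 := R.map_boundaryLoop e hC i 1
      have sT := A.prefixProd_succ T C i
      have sz := A.prefixProd_succ z C i
      set a := (A.order C).get i with ha
      simp only [Set.Icc.coe_zero, add_zero, Set.Icc.coe_one] at h0 h1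
      have h0' : p n = RelCWComplex.map 1 (R.edgeLabel.symm a) (edgePath (A.sign C a) 0) := h0
      have h1' : p (n + 1) =
          RelCWComplex.map 1 (R.edgeLabel.symm a) (edgePath (A.sign C a) 1) := by
        rw [← h1]
        simp only [p, i]
        push_cast
        rfl
      have ih' : A.prefixProd T C (i : ℕ) = A.prefixProd z C (i : ℕ) * ((V (p 0))⁻¹ * V (p n)) :=
        ih (by omega)
      have hcomm : ∀ P g y : G, y ∈ Subgroup.center G → P * g * y = P * y * g := fun P g y hy => by
        rw [mul_assoc, Subgroup.mem_center_iff.1 hy g, mul_assoc]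
      have key : A.prefixProd T C ((i : ℕ) + 1) =
          A.prefixProd z C ((i : ℕ) + 1) * ((V (p 0))⁻¹ * V (p (n + 1))) := by
        rw [sT, sz, ih']
        rcases Int.units_eq_one_or (A.sign C a) with hε | hε <;> rw [hε] at h0' h1' ⊢
        · have h0'' : p n = R.source a := h0'
          have h1'' : p (n + 1) = R.target a := h1'
          rw [h0'', h1'', Units.val_one, zpow_one, zpow_one, hT, ← mul_assoc,
            hcomm _ _ _ (hz a)]
          group
        -- A segment traversed backwards swaps source and target, and the letter is the inverse of
        -- the label; the central factor is moved past the telescoping part.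
        · rw [edgePath_neg_one_zero] at h0'
          rw [edgePath_neg_one_one] at h1'
          have h0'' : p n = R.target a := h0'
          have h1'' : p (n + 1) = R.source a := h1'
          rw [h0'', h1'', Units.val_neg, Units.val_one, zpow_neg_one, zpow_neg_one, hT,
            ← hcomm _ _ _ (inv_mem (hz a))]
          group
      push_cast
      exact key
  -- The boundary is a closed path, so the coboundary part of the full word is trivial.
  have hlast := hp _ le_rfl
  have hpk : p (A.order C).length = p 0 := by
    rcases Nat.eq_zero_or_pos (A.order C).length with h | h
    · rw [h]
    · have hk : ((A.order C).length : ℝ) ≠ 0 := by exact_mod_cast h.ne'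
      simp only [p, div_self hk, Nat.cast_zero, zero_div]
      rw [← boundaryLoop_fract 1, Int.fract_one]
  rwa [hpk, inv_mul_cancel, mul_one, prefixProd_length, prefixProd_length] at hlast

variable [SimplyConnectedSpace X]

include R in
/-- A projective solution on a simply connected complex is equivalent to a scalar one. -/
theorem exists_central_labelling {G K : Type*} [Group G] [CommGroup K] (ι : K →* G)
    (hι : Function.Injective ι) (hc : ∀ k, ι k ∈ Subgroup.center G) (T : L → G) (σ : A.Context → K)
    (hT : ∀ C, (A.word T C).prod = ι (σ C)) :
    ∃ z : L → K, ∀ C, (A.word z C).prod = σ C := by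
  have hN : ι.range.Normal := ⟨by
    rintro _ ⟨k, rfl⟩ g
    rw [Subgroup.mem_center_iff.1 (hc k) g, mul_inv_cancel_right]
    exact ⟨k, rfl⟩⟩
  -- Modulo the central subgroup all context words become trivial, so there is a potential in the
  -- quotient.
  obtain ⟨V, hV⟩ := A.exists_potential R.toSing (fun a => QuotientGroup.mk' ι.range (T a))
    fun C => by
      rw [word_map, hT]
      exact (QuotientGroup.eq_one_iff _).2 ⟨_, rfl⟩
  -- Any pointwise lift of the potential will do: the error on each edge lies in the central
  -- subgroup and defines `z`.
  choose W hW using fun x => QuotientGroup.mk'_surjective ι.range (V x)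
  have hk : ∀ a, ∃ k, ι k = T a * ((W (R.source a))⁻¹ * W (R.target a))⁻¹ := by
    intro a
    have h := hV a _ _ (R.path a) (R.toSing_path a)
    have : QuotientGroup.mk' ι.range (T a * ((W (R.source a))⁻¹ * W (R.target a))⁻¹) = 1 := by
      simp only [map_mul, map_inv, hW, h]
      group
    exact (QuotientGroup.eq_one_iff _).1 this
  choose z hz using hk
  refine ⟨z, fun C => hι ?_⟩
  rw [← hT, ← word_map]
  exact (R.prod_word_of_eq_mul (fun a => hc (z a)) W (fun a => by rw [hz]; group) C).symm

include R in
/-- A scalar solution with right-hand sides of exponent `d` can be replaced by one of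
exponent `d`. -/
theorem exists_labelling_pow_eq_one {K : Type*} [CommGroup K] {d : ℕ}
    (hroot : ∀ k : K, ∃ r, r ^ d = k) (z : L → K) (hz : ∀ C, (A.word z C).prod ^ d = 1) :
    ∃ ζ : L → K, (∀ a, ζ a ^ d = 1) ∧ ∀ C, (A.word ζ C).prod = (A.word z C).prod := by
  obtain ⟨V, hV⟩ := A.exists_potential R.toSing (fun a => powMonoidHom d (z a)) fun C => by
    rw [word_map]
    exact hz C
  -- Pointwise roots suffice, with no continuity required: the coboundary of `W` has `d`-th power `z
  -- ^ d` on every edge.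
  choose W hW using fun x => hroot (V x)
  have hV' := fun a => hV a _ _ (R.path a) (R.toSing_path a)
  refine ⟨fun a => z a * ((W (R.source a))⁻¹ * W (R.target a))⁻¹, fun a => ?_, fun C => ?_⟩
  · simp only [mul_pow, inv_pow, hW, hV', powMonoidHom_apply]
    group
  · exact (R.prod_word_of_eq_mul (fun a => by rw [CommGroup.center_eq_top]; trivial) W
      (fun a => by rw [inv_mul_cancel_right]) C).symm

/-! ### Roots of unity and the conclusion -/

theorem exists_stdAddChar_eq {d : ℕ} [NeZero d] {ζ : ℂ} (h : ζ ^ d = 1) :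
    ∃ j : ZMod d, (ZMod.stdAddChar j : ℂ) = ζ := by
  obtain ⟨i, -, hi⟩ := (Complex.isPrimitiveRoot_exp d (NeZero.ne d)).eq_pow_of_pow_eq_one h
  refine ⟨((i : ℤ) : ZMod d), ?_⟩
  rw [ZMod.stdAddChar_coe, ← hi, ← Complex.exp_nat_mul]
  congr 1
  push_cast
  ring

theorem stdAddChar_intCast_mul {d : ℕ} [NeZero d] (m : ℤ) (j : ZMod d) :
    (ZMod.stdAddChar ((m : ZMod d) * j) : ℂ) = (ZMod.stdAddChar j : ℂ) ^ m := by
  rw [← zsmul_eq_mul, AddChar.map_zsmul_eq_zpow]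

-- The two reductions are applied with scalars `ℂˣ` inside `GL_n(ℂ)`. Positivity of `n` makes the
-- scalars embed, and algebraic closedness of `ℂ` provides the `d`-th roots. The resulting `d`-th
-- roots of unity are powers of `ω`, whose exponents form `c`.
include R in
theorem classicallyRealizable {d : ℕ} [NeZero d] {τ : A.Context → ZMod d}
    (h : A.OperatorRealizable τ) : A.ClassicallyRealizable τ := by
  obtain ⟨n, hn, T, hT⟩ := h
  have : Nonempty (Fin n) := ⟨⟨0, hn⟩⟩
  let ι : ℂˣ →* (Matrix (Fin n) (Fin n) ℂ)ˣ :=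
    Units.map (algebraMap ℂ (Matrix (Fin n) (Fin n) ℂ)).toMonoidHom
  have hι : Function.Injective ι :=
    Units.map_injective (algebraMap ℂ (Matrix (Fin n) (Fin n) ℂ)).injective
  have hc : ∀ k, ι k ∈ Subgroup.center (Matrix (Fin n) (Fin n) ℂ)ˣ := fun k =>
    Subgroup.mem_center_iff.2 fun g => Units.ext (Algebra.commutes _ _).symm
  let σ : A.Context → ℂˣ := fun C =>
    Units.mk0 (ZMod.stdAddChar (τ C) : ℂ) (Circle.coe_ne_zero _)
  have hσ : ∀ C, σ C ^ d = 1 := fun C => Units.ext (by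
    change (ZMod.stdAddChar (τ C) : ℂ) ^ d = 1
    rw [← AddChar.map_nsmul_eq_pow, nsmul_eq_mul, CharP.cast_eq_zero, zero_mul,
      AddChar.map_zero_eq_one])
  obtain ⟨z, hz⟩ := R.exists_central_labelling ι hι hc (fun a => Unitary.toUnits (T a)) σ
    fun C => by
      rw [word_map]
      refine Units.ext ?_
      change (((A.order C).map fun a => T a ^ (A.sign C a : ℤ)).prod :
        Matrix (Fin n) (Fin n) ℂ) = algebraMap ℂ _ (ZMod.stdAddChar (τ C) : ℂ)
      rw [hT.constraint, Algebra.algebraMap_eq_smul_one]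
  obtain ⟨ζ, hζ, hζz⟩ := R.exists_labelling_pow_eq_one (d := d) (fun k => by
    obtain ⟨r, hr⟩ := IsAlgClosed.exists_pow_nat_eq (k : ℂ) (NeZero.pos d)
    have hr0 : r ≠ 0 := by
      rintro rfl
      rw [zero_pow (NeZero.ne d)] at hr
      exact k.ne_zero hr.symm
    exact ⟨Units.mk0 r hr0, Units.ext (by simpa using hr)⟩) z fun C => by rw [hz, hσ]
  choose c hcζ using fun a => exists_stdAddChar_eq (d := d) (ζ := (ζ a : ℂ)) (by
    rw [← Units.val_pow_eq_pow_val, hζ, Units.val_one])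
  refine ⟨c, fun C => ?_⟩
  have h := congrArg (Units.val) ((hζz C).trans (hz C))
  rw [word_prod_eq_prod, Units.coe_prod] at h
  rw [show (ZMod.stdAddChar (τ C) : ℂ) = σ C from rfl, ← h]
  refine Finset.prod_congr rfl fun a _ => ?_
  rw [stdAddChar_intCast_mul, hcζ, Units.val_zpow_eq_zpow_val]

-- Since incidence numbers are the signs, a classical realization, carried over to the edges of `X`,
-- is a 1-cochain with coboundary `τ`. Injectivity of the standard character turns the
-- multiplicative equations into additive ones.
omit [SimplyConnectedSpace X] in
theorem cohomologyClass_eq_zero [Finite L] {d : ℕ} [NeZero d] {τ : A.Context → ZMod d}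
    (h : A.ClassicallyRealizable τ) : R.cohomologyClass τ = 0 := by
  classical
  obtain ⟨c, hc⟩ := h
  have hfin := R.finite_edges
  refine (QuotientAddGroup.eq_zero_iff _).2 ⟨fun a => c (R.edgeLabel a), funext fun e => ?_⟩
  have hsum : ∑ a ∈ (R.faceLabel e).1, ((A.sign (R.faceLabel e) a : ℤ) : ZMod d) * c a =
      τ (R.faceLabel e) := by
    apply ZMod.injective_stdAddChar
    rw [← hc]
    exact map_prod (ZMod.stdAddChar (N := d)).toMonoidHom
      (fun a => Multiplicative.ofAdd (((A.sign (R.faceLabel e) a : ℤ) : ZMod d) * c a)) _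
  change ∑ᶠ a, (incidence e a : ZMod d) * c (R.edgeLabel a) = _
  simp only [R.incidence_eq]
  rw [finsum_comp_equiv R.edgeLabel (f := fun a => ((if a ∈ (R.faceLabel e).1 then
    (A.sign (R.faceLabel e) a : ℤ) else 0 : ℤ) : ZMod d) * c a),
    finsum_eq_sum_of_support_subset (s := (R.faceLabel e).1), ← hsum]
  · exact Finset.sum_congr rfl fun a ha => by rw [if_pos ha]
  · intro a ha
    by_contra h
    exact ha (by simp [show a ∉ (R.faceLabel e).1 from h])

end TopologicalRealization

end SignedArrangement

theorem mainTheorem1 {L : Type u} [Finite L] (A : SignedArrangement L)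
    {X : Type v} [TopologicalSpace X] [T2Space X] [CWComplex (Set.univ : Set X)]
    (R : A.TopologicalRealization X) [SimplyConnectedSpace X]
    (d : ℕ) [NeZero d] (hd : 2 ≤ d) :
    ¬ A.IsMagic d ∧
      ∀ τ : A.Context → ZMod d, A.OperatorRealizable τ →
        R.cohomologyClass τ = 0 ∧ A.ClassicallyRealizable τ := by
  refine ⟨?_, fun τ h => ⟨R.cohomologyClass_eq_zero (R.classicallyRealizable h),
    R.classicallyRealizable h⟩⟩
  rintro ⟨τ, ⟨n, hn, T, hT⟩, hτ⟩
  exact hτ (R.classicallyRealizable ⟨n, hn, T, hT.toIsOperatorRealization⟩)
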